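/- Let $n\ge 2$ and let $(F^n,g)$ be a smooth ($C^\infty$) Riemannian manifold without boundary (Hausdorff and second countable; orientability is not needed). Let $N^{n-1}\subset F$ be a smoothly embedded hypersurface which separates $F$ into two sides: $F\setminus N=F_+\cup F_-$ with $F_+,F_-$ open and disjoint, and let $\nu$ be the unit normal of $N$ for which, along all of $N$, $\nu$ points into $F_+$ and $-\nu$ points into $F_-$. Write $\Delta$ for the Laplace–Beltrami operator $\operatorname{div}\operatorname{grad}$ and $\operatorname{scal}$ for the scalar curvature of $(F,g)$. Let $f_1,f_2>0$ be smooth functions on $F$ with $$-\Delta f_i+\frac{n-2}{4(n-1)}\,\operatorname{scal}\cdot f_i>0\ \text{ on } F\quad(i=1,2),\qquad f_1=f_2\ \text{ and }\ \frac{\partial f_1}{\partial \nu}>\frac{\partial f_2}{\partial \nu}\ \text{ on } N .$$ Then each $p\in N$ has a neighborhood $U$ in $F$ with $f_2<f_1$ on $U\cap F_+$ and $f_1<f_2$ on $U\cap F_-$ (so near $N$ the smaller function is $f_2$ on the side $F_+$ and $f_1$ on the side $F_-$), and for every neighborhood $E$ of $N$ in $F$ there is a smooth function $f_E>0$ on $F$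 with $$-\Delta f_E+\frac{n-2}{4(n-1)}\,\operatorname{scal}\cdot f_E>0\ \text{ on } F,\qquad f_E=f_2\ \text{ on } F_+\setminus E,\qquad f_E=f_1\ \text{ on } F_-\setminus E .$$ -/

import Mathlib

open Set Filter Topology
open scoped Manifold ContDiff

noncomputable section

namespace ConformalSmoothing

/-- A smooth Riemannian metric on a smooth `n`-manifold `F` (without boundary). -/
abbrev SmoothMetric (n : ℕ) (F : Type*) [TopologicalSpace F]
    [ChartedSpace (EuclideanSpace ℝ (Fin n)) F] [IsManifold (𝓡 n) ∞ F] :=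
  Bundle.ContMDiffRiemannianMetric (𝓡 n) ∞ (EuclideanSpace ℝ (Fin n))
    (fun x : F => TangentSpace (𝓡 n) x)

/-- The `i`-th partial derivative at `y` of a real function on `ℝⁿ`. -/
def pderiv {n : ℕ} (i : Fin n) (h : EuclideanSpace ℝ (Fin n) → ℝ)
    (y : EuclideanSpace ℝ (Fin n)) : ℝ :=
  fderiv ℝ h y (EuclideanSpace.single i 1)

section Coordinates

variable {n : ℕ} {F : Type*} [TopologicalSpace F]
  [ChartedSpace (EuclideanSpace ℝ (Fin n)) F]

/-- The tangent vector `v` at `p` points into `S`: it is the velocity at time `0` of a curve that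
starts at `p` and runs in `S` for small positive times. -/
def PointsInto (p : F) (v : TangentSpace (𝓡 n) p) (S : Set F) : Prop :=
  ∃ γ : ℝ → F, γ 0 = p ∧
    HasMFDerivAt 𝓘(ℝ, ℝ) (𝓡 n) γ 0 ((1 : ℝ →L[ℝ] ℝ).smulRight (v : EuclideanSpace ℝ (Fin n))) ∧
    ∀ᶠ t in 𝓝[>] (0 : ℝ), γ t ∈ S

/-- The derivative `∂f/∂v` of a real function `f` at `p` in the direction of a tangent vector. -/
def dirDeriv (f : F → ℝ) (p : F) (v : TangentSpace (𝓡 n) p) : ℝ :=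
  mfderiv (𝓡 n) 𝓘(ℝ, ℝ) f p v

/-- The coordinate vector `∂ᵢ` of the chart `e`, at the point with coordinates `y`. -/
def coordVec (e : OpenPartialHomeomorph F (EuclideanSpace ℝ (Fin n)))
    (y : EuclideanSpace ℝ (Fin n)) (i : Fin n) : TangentSpace (𝓡 n) (e.symm y) :=
  mfderiv (𝓡 n) (𝓡 n) e.symm y (EuclideanSpace.single i (1 : ℝ))

variable [IsManifold (𝓡 n) ∞ F] (g : SmoothMetric n F)
  (e : OpenPartialHomeomorph F (EuclideanSpace ℝ (Fin n)))

/-- The coefficients `gᵢⱼ = g(∂ᵢ, ∂ⱼ)` of the metric in the chart `e`. -/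
def metricMatrix (y : EuclideanSpace ℝ (Fin n)) : Matrix (Fin n) (Fin n) ℝ :=
  Matrix.of fun i j => g.inner (e.symm y) (coordVec e y i) (coordVec e y j)

/-- The coefficients `gⁱʲ` of the inverse matrix. -/
def invMetric (i j : Fin n) (y : EuclideanSpace ℝ (Fin n)) : ℝ :=
  (metricMatrix g e y)⁻¹ i j

/-- Christoffel symbols `Γᵏᵢⱼ = ½ ∑ₗ gᵏˡ (∂ᵢ gⱼₗ + ∂ⱼ gᵢₗ - ∂ₗ gᵢⱼ)`. -/
def christoffel (k i j : Fin n) (y : EuclideanSpace ℝ (Fin n)) : ℝ :=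
  (1 / 2) * ∑ l, invMetric g e k l y *
    (pderiv i (fun z => metricMatrix g e z j l) y
      + pderiv j (fun z => metricMatrix g e z i l) y
      - pderiv l (fun z => metricMatrix g e z i j) y)

/-- Coefficients `Rˡₖᵢⱼ` of the curvature tensor, defined by
`R(∂ᵢ, ∂ⱼ) ∂ₖ = ∇ᵢ ∇ⱼ ∂ₖ - ∇ⱼ ∇ᵢ ∂ₖ = ∑ₗ Rˡₖᵢⱼ ∂ₗ`. -/
def riemann (l k i j : Fin n) (y : EuclideanSpace ℝ (Fin n)) : ℝ :=
  pderiv i (christoffel g e l j k) y - pderiv j (christoffel g e l i k) y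
    + ∑ m, (christoffel g e l i m y * christoffel g e m j k y
      - christoffel g e l j m y * christoffel g e m i k y)

/-- Ricci curvature `Ricⱼₖ = ∑ᵢ Rⁱₖᵢⱼ` (the trace of `X ↦ R(X, ∂ⱼ) ∂ₖ`). -/
def ricci (j k : Fin n) (y : EuclideanSpace ℝ (Fin n)) : ℝ :=
  ∑ i, riemann g e i k i j y

/-- Scalar curvature `∑ gʲᵏ Ricⱼₖ` in the chart `e`. -/
def scalInChart (y : EuclideanSpace ℝ (Fin n)) : ℝ :=
  ∑ j, ∑ k, invMetric g e j k y * ricci g e j k y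

/-- The Laplacian `∑ gⁱʲ (∂ᵢ ∂ⱼ f - ∑ₖ Γᵏᵢⱼ ∂ₖ f)` (the trace of the Hessian) in the chart `e`. -/
def laplacianInChart (f : F → ℝ) (y : EuclideanSpace ℝ (Fin n)) : ℝ :=
  ∑ i, ∑ j, invMetric g e i j y *
    (pderiv i (pderiv j (f ∘ e.symm)) y
      - ∑ k, christoffel g e k i j y * pderiv k (f ∘ e.symm) y)

end Coordinates

section Global

variable {n : ℕ} {F : Type*} [TopologicalSpace F]
  [ChartedSpace (EuclideanSpace ℝ (Fin n)) F] [IsManifold (𝓡 n) ∞ F] (g : SmoothMetric n F)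

/-- Scalar curvature of `(F, g)`. It does not depend on the chart used to compute it; the preferred
chart at the point is used. -/
def scal (x : F) : ℝ :=
  scalInChart g (chartAt (EuclideanSpace ℝ (Fin n)) x) (chartAt (EuclideanSpace ℝ (Fin n)) x x)

/-- Laplace-Beltrami operator `Δ f = div grad f` of `(F, g)` (negative semidefinite sign). It does
not depend on the chart used to compute it; the preferred chart at the point is used. -/
def laplacian (f : F → ℝ) (x : F) : ℝ :=
  laplacianInChart g (chartAt (EuclideanSpace ℝ (Fin n)) x) f
    (chartAt (EuclideanSpace ℝ (Fin n)) x x)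

/-- The conformal Laplacian `-Δ f + (n - 2) / (4 (n - 1)) · scal · f`. -/
def conformalLaplacian (f : F → ℝ) (x : F) : ℝ :=
  -laplacian g f x + ((n : ℝ) - 2) / (4 * ((n : ℝ) - 1)) * scal g x * f x

/-- The vector `v` at `ι x` is a unit normal vector of the hypersurface `ι : N → F` at `x`. -/
def IsUnitNormal {N : Type*} [TopologicalSpace N]
    [ChartedSpace (EuclideanSpace ℝ (Fin (n - 1))) N] (ι : N → F) (x : N)
    (v : TangentSpace (𝓡 n) (ι x)) : Prop :=
  g.inner (ι x) v v = 1 ∧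
    ∀ w : TangentSpace (𝓡 (n - 1)) x, g.inner (ι x) v (mfderiv (𝓡 (n - 1)) (𝓡 n) ι x w) = 0

end Global

end ConformalSmoothing

end

/-!
Write `f₁ = f₂ (1 + r)`. The function `r` vanishes on the hypersurface and has positive derivative
along `ν` there, so near the hypersurface it is positive on the side `P`, negative on the side `M`,
and has nonzero gradient. Hence it suffices to replace `min f₁ f₂ = f₂ (1 + min r 0)` by
`f₂ (1 + δ η(r / δ))`, where `η` is a smooth concave function which is `0` on `[1, ∞)` and the
identity on `(-∞, -1]`, and `δ > 0` is a smooth function that prescribes the width of the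
transition region.

With `L` the conformal Laplacian, `L (f (1 + a)) = (1 + a) L f - f (Δ a + 2 ⟨∇ log f, ∇ a⟩)`. Put
`s = r / δ`. For `a = δ η(s)` the terms containing `η(s)` and `η'(s)` combine to a combination of
`L f₂` and `L f₁` with nonnegative coefficients, up to errors controlled by the first and second
derivatives of `δ`. Concavity contributes `-δ η''(s) |∇ s|² ≥ 0`, of order `|∇ r|² / δ`, and it
dominates the errors when `δ` and its derivatives are small compared with `|∇ r|²`. The errors are
sublinear in `δ`, so a locally finite sum of bump functions with small coefficients is such a `δ`.
-/

noncomputable section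

set_option maxSynthPendingDepth 3

namespace ConformalSmoothing

/-! ### Traces of bilinear forms -/

section Trace

open Matrix Module
open LinearMap (BilinForm)
open LinearMap.BilinForm

variable {R M M' ι : Type*} [CommRing R] [AddCommGroup M] [Module R M] [AddCommGroup M']
  [Module R M'] [Fintype ι] [DecidableEq ι]

/-- The trace of the bilinear form `β` with respect to the bilinear form `B`, computed in the
basis `b`; by `formTrace_comp` it does not depend on the basis. It is meaningful only if `B` is
nondegenerate: otherwise the inverse Gram matrix is the junk value `0`. -/
def formTrace (b : Basis ι R M) (B : BilinForm R M) : BilinForm R M →ₗ[R] R where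
  toFun β := ((toMatrix b B)⁻¹ * (toMatrix b β)ᵀ).trace
  map_add' β γ := by rw [map_add, transpose_add, mul_add, trace_add]
  map_smul' c β := by rw [map_smul, transpose_smul, Matrix.mul_smul, trace_smul, RingHom.id_apply]

theorem formTrace_apply (b : Basis ι R M) (B β : BilinForm R M) :
    formTrace b B β = ∑ i, ∑ j, (toMatrix b B)⁻¹ i j * β (b i) (b j) := by
  simp only [formTrace, LinearMap.coe_mk, AddHom.coe_mk, trace, diag_apply, mul_apply,
    transpose_apply, toMatrix_apply]

theorem formTrace_comp (b : Basis ι R M) (c : Basis ι R M') (J : M' ≃ₗ[R] M)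
    (B β : BilinForm R M) :
    formTrace c (B.comp J J) (β.comp J J) = formTrace b B β := by
  have hJ : IsUnit (LinearMap.toMatrix c b J).det := J.isUnit_det c b
  simp only [formTrace, LinearMap.coe_mk, AddHom.coe_mk, toMatrix_comp b c]
  set A := LinearMap.toMatrix c b J
  set G := toMatrix b B
  set H := toMatrix b β
  calc ((Aᵀ * G * A)⁻¹ * (Aᵀ * H * A)ᵀ).trace
      = (A⁻¹ * (G⁻¹ * ((Aᵀ)⁻¹ * Aᵀ) * Hᵀ * A)).trace := by
        simp only [Matrix.mul_inv_rev, transpose_mul, transpose_transpose, Matrix.mul_assoc]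
    _ = (G⁻¹ * Hᵀ).trace := by
        rw [nonsing_inv_mul _ ((det_transpose A).symm ▸ hJ), trace_mul_comm, Matrix.mul_assoc,
          mul_nonsing_inv _ hJ, Matrix.mul_one, Matrix.mul_one]

theorem formTrace_flip {B : BilinForm R M} (b : Basis ι R M) (hB : B.IsSymm)
    (β : BilinForm R M) : formTrace b B β.flip = formTrace b B β := by
  have hG : ((toMatrix b B)⁻¹)ᵀ = (toMatrix b B)⁻¹ := by
    rw [transpose_nonsing_inv, (isSymm_toMatrix_iff_isSymm b).2 hB]
  rw [formTrace_apply, formTrace_apply, Finset.sum_comm]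
  refine Finset.sum_congr rfl fun i _ => Finset.sum_congr rfl fun j _ => ?_
  rw [← congrFun₂ hG i j, transpose_apply, flip_apply]

theorem formTrace_linMulLin_comm {B : BilinForm R M} (b : Basis ι R M) (hB : B.IsSymm)
    (φ ψ : M →ₗ[R] R) :
    formTrace b B (linMulLin φ ψ) = formTrace b B (linMulLin ψ φ) := by
  rw [← formTrace_flip b hB]
  congr 1
  ext
  simp [mul_comm]

theorem formTrace_linMulLin_self_pos {V : Type*} [AddCommGroup V] [Module ℝ V]
    {B : BilinForm ℝ V} (b : Basis ι ℝ V) (hB : B.IsSymm) (hpos : B.toQuadraticMap.PosDef)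
    {φ : V →ₗ[ℝ] ℝ} (hφ : φ ≠ 0) : 0 < formTrace b B (linMulLin φ φ) := by
  have hG := ((posDef_toQuadraticMap_iff_matrix b B hB).1 hpos).inv
  have hv : (fun i => φ (b i)) ≠ 0 := fun h => hφ (b.ext (congrFun h))
  refine (hG.dotProduct_mulVec_pos hv).trans_eq ?_
  simp only [formTrace_apply, linMulLin_apply, dotProduct, mulVec, star_trivial,
    Finset.mul_sum, mul_left_comm]

end Trace

/-! ### The Koszul form of a metric -/

section Koszul

variable {E E' : Type*} [NormedAddCommGroup E] [NormedSpace ℝ E] [NormedAddCommGroup E']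
  [NormedSpace ℝ E']

/-- The Christoffel symbols of the first kind of a metric on a vector space, as a function of the
derivative `T` of the metric at a point, `T u` being the derivative in the direction `u`. -/
def koszul (T : E →L[ℝ] E →L[ℝ] E →L[ℝ] ℝ) : E →L[ℝ] E →L[ℝ] E →L[ℝ] ℝ :=
  (1 / 2 : ℝ) •
    (T + T.flip - (ContinuousLinearMap.flipₗᵢ ℝ E E ℝ).toContinuousLinearEquiv ∘L T.flip)

theorem koszul_apply (T : E →L[ℝ] E →L[ℝ] E →L[ℝ] ℝ) (u v w : E) :
    koszul T u v w = 1 / 2 * (T u v w + T v u w - T w u v) := by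
  simp [koszul]

theorem fderiv_clm_apply₂_const {B : E → E' →L[ℝ] E' →L[ℝ] ℝ} {y : E}
    (hB : DifferentiableAt ℝ B y) (u : E) (v w : E') :
    fderiv ℝ (fun z => B z v w) y u = fderiv ℝ B y u v w := by
  have h := (hB.hasFDerivAt.clm_apply (hasFDerivAt_const v y)).clm_apply (hasFDerivAt_const w y)
  rw [h.fderiv]
  simp

theorem fderiv_pullback_apply {B : E' → E' →L[ℝ] E' →L[ℝ] ℝ} {φ : E → E'} {y : E}
    (hB : DifferentiableAt ℝ B (φ y)) (hφ : ContDiffAt ℝ 2 φ y) (u v w : E) :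
    fderiv ℝ (fun z => B (φ z) (fderiv ℝ φ z v) (fderiv ℝ φ z w)) y u =
      fderiv ℝ B (φ y) (fderiv ℝ φ y u) (fderiv ℝ φ y v) (fderiv ℝ φ y w)
        + B (φ y) (fderiv ℝ (fderiv ℝ φ) y u v) (fderiv ℝ φ y w)
        + B (φ y) (fderiv ℝ φ y v) (fderiv ℝ (fderiv ℝ φ) y u w) := by
  have hφ' : HasFDerivAt (fderiv ℝ φ) (fderiv ℝ (fderiv ℝ φ) y) y :=
    ((hφ.fderiv_right (m := 1) le_rfl).differentiableAt one_ne_zero).hasFDerivAt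
  have hBφ : HasFDerivAt (fun z => B (φ z)) (fderiv ℝ B (φ y) ∘L fderiv ℝ φ y) y :=
    HasFDerivAt.comp (g := B) y hB.hasFDerivAt (hφ.differentiableAt two_ne_zero).hasFDerivAt
  have hv := hφ'.clm_apply (hasFDerivAt_const v y)
  have hw := hφ'.clm_apply (hasFDerivAt_const w y)
  rw [((hBφ.clm_apply hv).clm_apply hw).fderiv]
  simp only [ContinuousLinearMap.comp_zero, zero_add, ContinuousLinearMap.flip_add, add_apply,
    ContinuousLinearMap.comp_apply, ContinuousLinearMap.flip_apply]
  ring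

theorem koszul_pullback {B : E → E →L[ℝ] E →L[ℝ] ℝ} {B' : E' → E' →L[ℝ] E' →L[ℝ] ℝ} {φ : E → E'}
    {y : E} (hB : DifferentiableAt ℝ B y) (hB' : DifferentiableAt ℝ B' (φ y))
    (hφ : ContDiffAt ℝ 2 φ y) (hsymm : ∀ u v, B' (φ y) u v = B' (φ y) v u)
    (h : ∀ᶠ z in 𝓝 y, B z = (B' (φ z)).bilinearComp (fderiv ℝ φ z) (fderiv ℝ φ z))
    (u v w : E) :
    koszul (fderiv ℝ B y) u v w =
      koszul (fderiv ℝ B' (φ y)) (fderiv ℝ φ y u) (fderiv ℝ φ y v) (fderiv ℝ φ y w)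
        + B' (φ y) (fderiv ℝ (fderiv ℝ φ) y u v) (fderiv ℝ φ y w) := by
  have hsnd : IsSymmSndFDerivAt ℝ φ y := hφ.isSymmSndFDerivAt (by simp)
  have hfderiv (a b c : E) : fderiv ℝ B y a b c =
      fderiv ℝ (fun z => B' (φ z) (fderiv ℝ φ z b) (fderiv ℝ φ z c)) y a := by
    rw [← fderiv_clm_apply₂_const hB]
    refine congrArg (fun L : E →L[ℝ] ℝ => L a) (EventuallyEq.fderiv_eq ?_)
    filter_upwards [h] with z hz
    rw [hz, ContinuousLinearMap.bilinearComp_apply]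
  simp only [koszul_apply, hfderiv, fderiv_pullback_apply hB' hφ]
  rw [hsnd v u, hsnd w u, hsnd w v, hsymm _ (fderiv ℝ (fderiv ℝ φ) y u w),
    hsymm (fderiv ℝ φ y u)]
  ring

end Koszul

/-! ### The metric, its Christoffel symbols and the Hessian in a chart -/

/-- Coordinate space `ℝⁿ`. -/
abbrev Euc (n : ℕ) := EuclideanSpace ℝ (Fin n)

/-- The standard basis of coordinate space, as an algebraic basis. -/
abbrev stdBasis (n : ℕ) : Module.Basis (Fin n) ℝ (Euc n) :=
  (EuclideanSpace.basisFun (Fin n) ℝ).toBasis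

theorem stdBasis_apply {n : ℕ} (i : Fin n) : stdBasis n i = EuclideanSpace.single i 1 := by
  rw [stdBasis, OrthonormalBasis.coe_toBasis, EuclideanSpace.basisFun_apply]

theorem clm_ext_single {n : ℕ} {G : Type*} [AddCommGroup G] [Module ℝ G] [TopologicalSpace G]
    {A B : Euc n →L[ℝ] G}
    (h : ∀ i, A (EuclideanSpace.single i 1) = B (EuclideanSpace.single i 1)) : A = B :=
  ContinuousLinearMap.coe_injective <| (stdBasis n).ext fun i => by
    rw [stdBasis_apply]
    exact h i

theorem pderiv_pderiv {n : ℕ} {h : Euc n → ℝ} {y : Euc n} (hh : DifferentiableAt ℝ (fderiv ℝ h) y)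
    (i j : Fin n) :
    pderiv i (pderiv j h) y =
      fderiv ℝ (fderiv ℝ h) y (EuclideanSpace.single i 1) (EuclideanSpace.single j 1) := by
  have hj := hh.hasFDerivAt.clm_apply (hasFDerivAt_const (EuclideanSpace.single j (1 : ℝ)) y)
  rw [pderiv, show pderiv j h = fun z => fderiv ℝ h z (EuclideanSpace.single j 1) from rfl,
    hj.fderiv]
  simp

section ChartMetric

variable {n : ℕ} {F : Type*} [TopologicalSpace F]
  [ChartedSpace (EuclideanSpace ℝ (Fin n)) F] [IsManifold (𝓡 n) ∞ F] (g : SmoothMetric n F)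
  (e : OpenPartialHomeomorph F (Euc n))

/-- The metric in the chart `e`, as a bilinear form on `ℝⁿ` depending on the point. -/
def chartMetric (y : Euc n) : Euc n →L[ℝ] Euc n →L[ℝ] ℝ :=
  let G : Euc n →L[ℝ] Euc n →L[ℝ] ℝ := g.inner (e.symm y)
  let D : Euc n →L[ℝ] Euc n := mfderiv (𝓡 n) (𝓡 n) e.symm y
  G.bilinearComp D D

theorem chartMetric_single (y : Euc n) (i j : Fin n) :
    chartMetric g e y (EuclideanSpace.single i 1) (EuclideanSpace.single j 1) =
      metricMatrix g e y i j := rfl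

theorem chartMetric_comm (y v w : Euc n) : chartMetric g e y v w = chartMetric g e y w v :=
  g.symm _ _ _

theorem chartMetric_isSymm (y : Euc n) : (chartMetric g e y).toBilinForm.IsSymm :=
  ⟨chartMetric_comm g e y⟩

theorem toMatrix_chartMetric (y : Euc n) :
    (chartMetric g e y).toBilinForm.toMatrix (stdBasis n) = metricMatrix g e y := by
  ext i j
  rw [LinearMap.BilinForm.toMatrix_apply, stdBasis_apply, stdBasis_apply,
    ContinuousLinearMap.toBilinForm_apply, chartMetric_single]

/-- The trace of a bilinear form with respect to the metric at the point with coordinates `y` in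
the chart `e`. -/
def chartTrace (y : Euc n) : (Euc n →L[ℝ] Euc n →L[ℝ] ℝ) →ₗ[ℝ] ℝ :=
  formTrace (stdBasis n) (chartMetric g e y).toBilinForm ∘ₗ ContinuousLinearMap.toLinearMap₁₂

theorem chartTrace_apply (y : Euc n) (β : Euc n →L[ℝ] Euc n →L[ℝ] ℝ) :
    chartTrace g e y β = ∑ i, ∑ j, invMetric g e i j y *
      β (EuclideanSpace.single i 1) (EuclideanSpace.single j 1) := by
  rw [chartTrace, LinearMap.comp_apply, formTrace_apply, toMatrix_chartMetric]
  simp only [stdBasis_apply, ContinuousLinearMap.toLinearMap₁₂_apply_apply_apply, invMetric]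

theorem chartTrace_smulRight_add (y : Euc n) (φ ψ χ : Euc n →L[ℝ] ℝ) :
    chartTrace g e y (φ.smulRight (ψ + χ)) =
      chartTrace g e y (φ.smulRight ψ) + chartTrace g e y (φ.smulRight χ) :=
  map_add (chartTrace g e y ∘ₗ φ.smulRightₗ) ψ χ

theorem chartTrace_smulRight_smul (y : Euc n) (c : ℝ) (φ ψ : Euc n →L[ℝ] ℝ) :
    chartTrace g e y (φ.smulRight (c • ψ)) = c * chartTrace g e y (φ.smulRight ψ) :=
  map_smul (chartTrace g e y ∘ₗ φ.smulRightₗ) c ψ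

theorem chartTrace_smulRight_comm (y : Euc n) (φ ψ : Euc n →L[ℝ] ℝ) :
    chartTrace g e y (φ.smulRight ψ) = chartTrace g e y (ψ.smulRight φ) :=
  formTrace_linMulLin_comm (stdBasis n) (chartMetric_isSymm g e y) (φ : Euc n →ₗ[ℝ] ℝ) ψ

/-- The Christoffel symbols in the chart `e`, as the bilinear map `(u, v) ↦ Γ(u, v)`. -/
def christoffelMap (y : Euc n) : Euc n →L[ℝ] Euc n →L[ℝ] Euc n :=
  ∑ i, ∑ j, (EuclideanSpace.proj i : Euc n →L[ℝ] ℝ).smulRight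
    ((EuclideanSpace.proj j : Euc n →L[ℝ] ℝ).smulRight
      (∑ k, christoffel g e k i j y • EuclideanSpace.single k (1 : ℝ)))

theorem christoffelMap_single (y : Euc n) (i j : Fin n) :
    christoffelMap g e y (EuclideanSpace.single i 1) (EuclideanSpace.single j 1) =
      ∑ k, christoffel g e k i j y • EuclideanSpace.single k (1 : ℝ) := by
  simp [christoffelMap, _root_.sum_apply, ite_smul]

/-- The Hessian of `f` in the chart `e`. -/
def chartHessian (f : F → ℝ) (y : Euc n) : Euc n →L[ℝ] Euc n →L[ℝ] ℝ :=
  fderiv ℝ (fderiv ℝ (f ∘ e.symm)) y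
    - ContinuousLinearMap.compL ℝ (Euc n) (Euc n) ℝ (fderiv ℝ (f ∘ e.symm) y)
      ∘L christoffelMap g e y

theorem chartHessian_apply (f : F → ℝ) (y u v : Euc n) :
    chartHessian g e f y u v = fderiv ℝ (fderiv ℝ (f ∘ e.symm)) y u v
      - fderiv ℝ (f ∘ e.symm) y (christoffelMap g e y u v) := by
  simp [chartHessian]

theorem laplacianInChart_eq_chartTrace {f : F → ℝ} {y : Euc n}
    (hf : DifferentiableAt ℝ (fderiv ℝ (f ∘ e.symm)) y) :
    laplacianInChart g e f y = chartTrace g e y (chartHessian g e f y) := by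
  simp only [laplacianInChart, chartTrace_apply, chartHessian_apply, pderiv_pderiv hf,
    christoffelMap_single, map_sum, map_smul, smul_eq_mul]
  rfl

variable {e}

theorem chartMetric_self_pos (he : e ∈ atlas (Euc n) F) {y : Euc n} (hy : y ∈ e.target)
    {v : Euc n} (hv : v ≠ 0) : 0 < chartMetric g e y v v := by
  have hinj := (mdifferentiable_of_mem_atlas (I := 𝓡 n) he).symm.mfderiv_injective hy
  exact g.pos _ _ fun h => hv (hinj (h.trans (map_zero (mfderiv (𝓡 n) (𝓡 n) e.symm y)).symm))

theorem chartMetric_posDef (he : e ∈ atlas (Euc n) F) {y : Euc n} (hy : y ∈ e.target) :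
    (LinearMap.BilinMap.toQuadraticMap (chartMetric g e y).toBilinForm).PosDef :=
  fun _ hv => chartMetric_self_pos g he hy hv

theorem isUnit_det_metricMatrix (he : e ∈ atlas (Euc n) F) {y : Euc n} (hy : y ∈ e.target) :
    IsUnit (metricMatrix g e y).det := by
  have h := (LinearMap.BilinForm.posDef_toQuadraticMap_iff_matrix (stdBasis n) _
    (chartMetric_isSymm g e y)).1 (chartMetric_posDef g he hy)
  rw [toMatrix_chartMetric] at h
  exact h.det_pos.ne'.isUnit

theorem chartTrace_smulRight_self_pos (he : e ∈ atlas (Euc n) F) {y : Euc n} (hy : y ∈ e.target)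
    {φ : Euc n →L[ℝ] ℝ} (hφ : φ ≠ 0) : 0 < chartTrace g e y (φ.smulRight φ) :=
  formTrace_linMulLin_self_pos (stdBasis n) (chartMetric_isSymm g e y)
    (chartMetric_posDef g he hy) (φ := (φ : Euc n →ₗ[ℝ] ℝ))
    fun h => hφ (ContinuousLinearMap.coe_injective h)

theorem contMDiffOn_mfderiv_symm_apply (he : e ∈ atlas (Euc n) F) (v : Euc n) :
    ContMDiffOn (𝓡 n) ((𝓡 n).prod (𝓡 n)) ∞
      (fun z => (⟨e.symm z, mfderiv (𝓡 n) (𝓡 n) e.symm z v⟩ : TangentBundle (𝓡 n) F))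
      e.target := by
  have hsymm : ContMDiffOn (𝓡 n) (𝓡 n) ∞ e.symm e.target :=
    contMDiffOn_symm_of_mem_maximalAtlas (IsManifold.subset_maximalAtlas he)
  have htangent :=
    hsymm.contMDiffOn_tangentMapWithin (m := ∞) (by simp) e.open_target.uniqueMDiffOn
  have hconst : ContMDiffOn (𝓡 n) ((𝓡 n).prod (𝓡 n)) ∞
      (fun z => (⟨z, v⟩ : TangentBundle (𝓡 n) (Euc n))) e.target :=
    contMDiffOn_vectorSpace_iff_contDiffOn.2 contDiffOn_const
  refine (htangent.comp hconst fun z hz => hz).congr fun z hz => ?_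
  rw [Function.comp_apply, tangentMapWithin, mfderivWithin_of_isOpen e.open_target hz]

theorem contDiffOn_chartMetric (he : e ∈ atlas (Euc n) F) :
    ContDiffOn ℝ ∞ (chartMetric g e) e.target := by
  refine contDiffOn_clm_apply.2 fun v => contDiffOn_clm_apply.2 fun w => ?_
  have hsymm : ContMDiffOn (𝓡 n) (𝓡 n) ∞ e.symm e.target :=
    contMDiffOn_symm_of_mem_maximalAtlas (IsManifold.subset_maximalAtlas he)
  have hinner := ContMDiffOn.clm_bundle_apply₂ (F₁ := Euc n) (F₂ := Euc n) (F₃ := ℝ)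
    (E₃ := Bundle.Trivial F ℝ) (g.contMDiff.comp_contMDiffOn hsymm)
    (contMDiffOn_mfderiv_symm_apply he v) (contMDiffOn_mfderiv_symm_apply he w)
  exact contMDiffOn_iff_contDiffOn.1 fun z hz =>
    (Bundle.contMDiffWithinAt_totalSpace.1 (hinner z hz)).2

theorem differentiableAt_chartMetric (he : e ∈ atlas (Euc n) F) {y : Euc n} (hy : y ∈ e.target) :
    DifferentiableAt ℝ (chartMetric g e) y :=
  ((contDiffOn_chartMetric g he).contDiffAt (e.open_target.mem_nhds hy)).differentiableAt
    (by simp)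

theorem christoffel_eq_sum_koszul (he : e ∈ atlas (Euc n) F) {y : Euc n} (hy : y ∈ e.target)
    (k i j : Fin n) :
    christoffel g e k i j y = ∑ l, invMetric g e k l y *
      koszul (fderiv ℝ (chartMetric g e) y) (EuclideanSpace.single i 1)
        (EuclideanSpace.single j 1) (EuclideanSpace.single l 1) := by
  have hderiv (i j l : Fin n) : pderiv i (fun z => metricMatrix g e z j l) y =
      fderiv ℝ (chartMetric g e) y (EuclideanSpace.single i 1) (EuclideanSpace.single j 1)
        (EuclideanSpace.single l 1) :=
    fderiv_clm_apply₂_const (differentiableAt_chartMetric g he hy) _ _ _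
  simp only [christoffel, hderiv, koszul_apply, Finset.mul_sum, mul_left_comm]

theorem chartMetric_christoffelMap (he : e ∈ atlas (Euc n) F) {y : Euc n} (hy : y ∈ e.target)
    (u v w : Euc n) :
    chartMetric g e y (christoffelMap g e y u v) w =
      koszul (fderiv ℝ (chartMetric g e) y) u v w := by
  suffices h : ContinuousLinearMap.compL ℝ (Euc n) (Euc n) (Euc n →L[ℝ] ℝ) (chartMetric g e y)
      ∘L christoffelMap g e y = koszul (fderiv ℝ (chartMetric g e) y) from
    DFunLike.congr_fun (DFunLike.congr_fun (DFunLike.congr_fun h u) v) w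
  refine clm_ext_single fun i => clm_ext_single fun j => clm_ext_single fun l => ?_
  set K : Fin n → ℝ := fun m => koszul (fderiv ℝ (chartMetric g e) y)
    (EuclideanSpace.single i 1) (EuclideanSpace.single j 1) (EuclideanSpace.single m 1)
  calc chartMetric g e y (christoffelMap g e y (EuclideanSpace.single i 1)
        (EuclideanSpace.single j 1)) (EuclideanSpace.single l 1)
      = ∑ k, metricMatrix g e y l k * ∑ m, invMetric g e k m y * K m := by
        simp only [christoffelMap_single, map_sum, map_smul, _root_.sum_apply, _root_.smul_apply,
          smul_eq_mul, christoffel_eq_sum_koszul g he hy, K]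
        refine Finset.sum_congr rfl fun k _ => ?_
        rw [mul_comm, chartMetric_comm, chartMetric_single]
    _ = (metricMatrix g e y).mulVec ((metricMatrix g e y)⁻¹.mulVec K) l := rfl
    _ = K l := by
        rw [Matrix.mulVec_mulVec, Matrix.mul_nonsing_inv _ (isUnit_det_metricMatrix g he hy),
          Matrix.one_mulVec]

end ChartMetric

/-! ### Change of charts -/

theorem eventually_mem_target_source {X H : Type*} [TopologicalSpace X] [TopologicalSpace H]
    {e e' : OpenPartialHomeomorph X H} {y : H} (hy : y ∈ e.target) (hy' : e.symm y ∈ e'.source) :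
    ∀ᶠ z in 𝓝 y, z ∈ e.target ∧ e.symm z ∈ e'.source :=
  (e.open_target.eventually_mem hy).and
    ((e.continuousAt_symm hy).eventually (e'.open_source.eventually_mem hy'))

theorem comp_symm_eventuallyEq {X Y H : Type*} [TopologicalSpace X] [TopologicalSpace H]
    {e e' : OpenPartialHomeomorph X H} (f : X → Y) {y : H} (hy : y ∈ e.target)
    (hy' : e.symm y ∈ e'.source) :
    f ∘ e.symm =ᶠ[𝓝 y] (f ∘ e'.symm) ∘ (e' ∘ e.symm) := by
  filter_upwards [eventually_mem_target_source hy hy'] with z hz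
  simp only [Function.comp_apply, e'.left_inv hz.2]

section Charts

variable {n : ℕ} {F : Type*} [TopologicalSpace F] [ChartedSpace (EuclideanSpace ℝ (Fin n)) F]
  {k : WithTop ℕ∞} [IsManifold (𝓡 n) k F] {f : F → ℝ}
  {e e' : OpenPartialHomeomorph F (Euc n)}

theorem contDiffOn_comp_symm (he : e ∈ atlas (Euc n) F) (hf : ContMDiff (𝓡 n) 𝓘(ℝ, ℝ) k f) :
    ContDiffOn ℝ k (f ∘ e.symm) e.target :=
  contMDiffOn_iff_contDiffOn.1 <| hf.comp_contMDiffOn <|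
    contMDiffOn_symm_of_mem_maximalAtlas (IsManifold.subset_maximalAtlas he)

theorem contDiffAt_comp_symm (he : e ∈ atlas (Euc n) F) {y : Euc n} (hy : y ∈ e.target)
    (hf : ContMDiffAt (𝓡 n) 𝓘(ℝ, ℝ) k f (e.symm y)) : ContDiffAt ℝ k (f ∘ e.symm) y :=
  contMDiffAt_iff_contDiffAt.1 <| hf.comp y <|
    (contMDiffOn_symm_of_mem_maximalAtlas (IsManifold.subset_maximalAtlas he)).contMDiffAt
      (e.open_target.mem_nhds hy)

theorem differentiableAt_fderiv_comp_symm [IsManifold (𝓡 n) 2 F] (he : e ∈ atlas (Euc n) F)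
    {y : Euc n} (hy : y ∈ e.target) (hf : ContMDiffAt (𝓡 n) 𝓘(ℝ, ℝ) 2 f (e.symm y)) :
    DifferentiableAt ℝ (fderiv ℝ (f ∘ e.symm)) y :=
  ((contDiffAt_comp_symm he hy hf).fderiv_right (m := 1) le_rfl).differentiableAt one_ne_zero

theorem contDiffAt_transition (he : e ∈ atlas (Euc n) F) (he' : e' ∈ atlas (Euc n) F)
    {y : Euc n} (hy : y ∈ e.target) (hy' : e.symm y ∈ e'.source) :
    ContDiffAt ℝ k (e' ∘ e.symm) y := by
  have hsymm : ContMDiffAt (𝓡 n) (𝓡 n) k e.symm y :=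
    (contMDiffOn_symm_of_mem_maximalAtlas (IsManifold.subset_maximalAtlas he)).contMDiffAt
      (e.open_target.mem_nhds hy)
  have he'x : ContMDiffAt (𝓡 n) (𝓡 n) k e' (e.symm y) :=
    (contMDiffOn_of_mem_maximalAtlas (IsManifold.subset_maximalAtlas he')).contMDiffAt
      (e'.open_source.mem_nhds hy')
  exact contMDiffAt_iff_contDiffAt.1 (he'x.comp y hsymm)

theorem fderiv_transition_bijective [IsManifold (𝓡 n) 1 F] (he : e ∈ atlas (Euc n) F)
    (he' : e' ∈ atlas (Euc n) F) {y : Euc n} (hy : y ∈ e.target) (hy' : e.symm y ∈ e'.source) :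
    Function.Bijective (fderiv ℝ (e' ∘ e.symm) y) := by
  have hm := mdifferentiable_of_mem_atlas (I := 𝓡 n) he
  have hm' := mdifferentiable_of_mem_atlas (I := 𝓡 n) he'
  rw [← mfderiv_eq_fderiv,
    mfderiv_comp y (hm'.mdifferentiableAt hy') (hm.mdifferentiableAt_symm hy)]
  exact (hm'.mfderiv_bijective hy').comp (hm.symm.mfderiv_bijective hy)

end Charts

section Transition

variable {n : ℕ} {F : Type*} [TopologicalSpace F]
  [ChartedSpace (EuclideanSpace ℝ (Fin n)) F] [IsManifold (𝓡 n) ∞ F] (g : SmoothMetric n F)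
  {e e' : OpenPartialHomeomorph F (Euc n)}

theorem mfderiv_symm_transition (he : e ∈ atlas (Euc n) F) (he' : e' ∈ atlas (Euc n) F)
    {y : Euc n} (hy : y ∈ e.target) (hy' : e.symm y ∈ e'.source) (v : Euc n) :
    (mfderiv (𝓡 n) (𝓡 n) e.symm y v : Euc n) =
      (mfderiv (𝓡 n) (𝓡 n) e'.symm (e' (e.symm y)) (fderiv ℝ (e' ∘ e.symm) y v) : Euc n) := by
  have hm := mdifferentiable_of_mem_atlas (I := 𝓡 n) he
  have hm' := mdifferentiable_of_mem_atlas (I := 𝓡 n) he'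
  have hφ : MDifferentiableAt (𝓡 n) (𝓡 n) (e' ∘ e.symm) y :=
    (hm'.mdifferentiableAt hy').comp y (hm.mdifferentiableAt_symm hy)
  have hcomp := mfderiv_comp y (hm'.mdifferentiableAt_symm (e'.map_source hy')) hφ
  rw [mfderiv_eq_fderiv] at hcomp
  exact DFunLike.congr_fun
    (((comp_symm_eventuallyEq (e' := e') id hy hy').mfderiv_eq).trans hcomp) v

theorem chartMetric_transition (he : e ∈ atlas (Euc n) F) (he' : e' ∈ atlas (Euc n) F)
    {y : Euc n} (hy : y ∈ e.target) (hy' : e.symm y ∈ e'.source) :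
    chartMetric g e y = (chartMetric g e' (e' (e.symm y))).bilinearComp
      (fderiv ℝ (e' ∘ e.symm) y) (fderiv ℝ (e' ∘ e.symm) y) := by
  have hinner (p q : F) (hpq : p = q) (u v : Euc n) :
      g.inner p (u : TangentSpace (𝓡 n) p) (v : TangentSpace (𝓡 n) p) =
        g.inner q (u : TangentSpace (𝓡 n) q) (v : TangentSpace (𝓡 n) q) := by
    subst hpq
    rfl
  ext u v
  refine (congrArg₂ (fun a b : Euc n => g.inner (e.symm y) a b)
    (mfderiv_symm_transition he he' hy hy' u) (mfderiv_symm_transition he he' hy hy' v)).trans ?_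
  exact hinner _ _ (e'.left_inv hy').symm _ _

theorem chartMetric_separatingLeft (he : e ∈ atlas (Euc n) F) {y : Euc n} (hy : y ∈ e.target)
    {a b : Euc n} (h : ∀ w, chartMetric g e y a w = chartMetric g e y b w) : a = b := by
  by_contra hab
  refine (chartMetric_self_pos g he hy (sub_ne_zero.2 hab)).ne' ?_
  rw [map_sub (chartMetric g e y), _root_.sub_apply, h, sub_self]

theorem christoffelMap_transition (he : e ∈ atlas (Euc n) F) (he' : e' ∈ atlas (Euc n) F)
    {y : Euc n} (hy : y ∈ e.target) (hy' : e.symm y ∈ e'.source) (u v : Euc n) :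
    fderiv ℝ (e' ∘ e.symm) y (christoffelMap g e y u v) =
      christoffelMap g e' (e' (e.symm y)) (fderiv ℝ (e' ∘ e.symm) y u)
        (fderiv ℝ (e' ∘ e.symm) y v) + fderiv ℝ (fderiv ℝ (e' ∘ e.symm)) y u v := by
  have hφy : e' (e.symm y) ∈ e'.target := e'.map_source hy'
  have hpull : ∀ᶠ z in 𝓝 y, chartMetric g e z = (chartMetric g e' ((e' ∘ e.symm) z)).bilinearComp
      (fderiv ℝ (e' ∘ e.symm) z) (fderiv ℝ (e' ∘ e.symm) z) :=
    (eventually_mem_target_source hy hy').mono fun z hz =>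
      chartMetric_transition g he he' hz.1 hz.2
  refine chartMetric_separatingLeft g he' hφy fun w' => ?_
  obtain ⟨w, rfl⟩ := (fderiv_transition_bijective he he' hy hy').surjective w'
  rw [← ContinuousLinearMap.bilinearComp_apply, ← chartMetric_transition g he he' hy hy',
    chartMetric_christoffelMap g he hy,
    koszul_pullback (φ := e' ∘ e.symm) (differentiableAt_chartMetric g he hy)
      (differentiableAt_chartMetric g he' hφy)
      (contDiffAt_transition he he' hy hy')
      (chartMetric_comm g e' _) hpull,
    map_add, _root_.add_apply, chartMetric_christoffelMap g he' hφy, Function.comp_apply]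

theorem chartTrace_transition (he : e ∈ atlas (Euc n) F) (he' : e' ∈ atlas (Euc n) F)
    {y : Euc n} (hy : y ∈ e.target) (hy' : e.symm y ∈ e'.source)
    (β : Euc n →L[ℝ] Euc n →L[ℝ] ℝ) :
    chartTrace g e y
        (β.bilinearComp (fderiv ℝ (e' ∘ e.symm) y) (fderiv ℝ (e' ∘ e.symm) y)) =
      chartTrace g e' (e' (e.symm y)) β := by
  have h := formTrace_comp (stdBasis n) (stdBasis n)
    (LinearEquiv.ofBijective (fderiv ℝ (e' ∘ e.symm) y : Euc n →ₗ[ℝ] Euc n)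
      (fderiv_transition_bijective he he' hy hy'))
    (chartMetric g e' (e' (e.symm y))).toBilinForm β.toLinearMap₁₂
  rw [chartTrace, chartMetric_transition g he he' hy hy']
  exact h

theorem fderiv_comp_symm_transition (he : e ∈ atlas (Euc n) F) (he' : e' ∈ atlas (Euc n) F)
    {f : F → ℝ} (hf : ContMDiff (𝓡 n) 𝓘(ℝ, ℝ) 1 f) {y : Euc n} (hy : y ∈ e.target)
    (hy' : e.symm y ∈ e'.source) :
    fderiv ℝ (f ∘ e.symm) y =
      fderiv ℝ (f ∘ e'.symm) (e' (e.symm y)) ∘L fderiv ℝ (e' ∘ e.symm) y := by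
  rw [(comp_symm_eventuallyEq (e' := e') f hy hy').fderiv_eq]
  exact fderiv_comp y
    ((contDiffAt_comp_symm he' (e'.map_source hy') (hf _)).differentiableAt one_ne_zero)
    ((contDiffAt_transition he he' hy hy').differentiableAt one_ne_zero)

theorem fderiv_fderiv_comp_symm_transition (he : e ∈ atlas (Euc n) F) (he' : e' ∈ atlas (Euc n) F)
    {f : F → ℝ} (hf : ContMDiff (𝓡 n) 𝓘(ℝ, ℝ) 2 f) {y : Euc n} (hy : y ∈ e.target)
    (hy' : e.symm y ∈ e'.source) (u v : Euc n) :
    fderiv ℝ (fderiv ℝ (f ∘ e.symm)) y u v =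
      fderiv ℝ (fderiv ℝ (f ∘ e'.symm)) (e' (e.symm y)) (fderiv ℝ (e' ∘ e.symm) y u)
          (fderiv ℝ (e' ∘ e.symm) y v)
        + fderiv ℝ (f ∘ e'.symm) (e' (e.symm y)) (fderiv ℝ (fderiv ℝ (e' ∘ e.symm)) y u v) := by
  have hφ : ContDiffAt ℝ 2 (e' ∘ e.symm) y := contDiffAt_transition he he' hy hy'
  have hdf : HasFDerivAt (fun z => fderiv ℝ (f ∘ e'.symm) ((e' ∘ e.symm) z))
      (fderiv ℝ (fderiv ℝ (f ∘ e'.symm)) (e' (e.symm y)) ∘L fderiv ℝ (e' ∘ e.symm) y) y :=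
    HasFDerivAt.comp (g := fderiv ℝ (f ∘ e'.symm)) y
      (differentiableAt_fderiv_comp_symm he' (e'.map_source hy') (hf _)).hasFDerivAt
      (hφ.differentiableAt two_ne_zero).hasFDerivAt
  have hdφ : HasFDerivAt (fderiv ℝ (e' ∘ e.symm)) (fderiv ℝ (fderiv ℝ (e' ∘ e.symm)) y) y :=
    ((hφ.fderiv_right (m := 1) le_rfl).differentiableAt one_ne_zero).hasFDerivAt
  have hchain : fderiv ℝ (f ∘ e.symm) =ᶠ[𝓝 y] fun z =>
      fderiv ℝ (f ∘ e'.symm) ((e' ∘ e.symm) z) ∘L fderiv ℝ (e' ∘ e.symm) z :=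
    (eventually_mem_target_source hy hy').mono fun z hz =>
      fderiv_comp_symm_transition he he' (hf.of_le one_le_two) hz.1 hz.2
  rw [hchain.fderiv_eq, (hdf.clm_comp hdφ).fderiv]
  simp [add_comm]

theorem chartHessian_transition (he : e ∈ atlas (Euc n) F) (he' : e' ∈ atlas (Euc n) F)
    {f : F → ℝ} (hf : ContMDiff (𝓡 n) 𝓘(ℝ, ℝ) 2 f) {y : Euc n} (hy : y ∈ e.target)
    (hy' : e.symm y ∈ e'.source) :
    chartHessian g e f y = (chartHessian g e' f (e' (e.symm y))).bilinearComp
      (fderiv ℝ (e' ∘ e.symm) y) (fderiv ℝ (e' ∘ e.symm) y) := by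
  ext u v
  rw [ContinuousLinearMap.bilinearComp_apply, chartHessian_apply, chartHessian_apply,
    fderiv_fderiv_comp_symm_transition he he' hf hy hy',
    fderiv_comp_symm_transition he he' (hf.of_le one_le_two) hy hy',
    ContinuousLinearMap.comp_apply, christoffelMap_transition g he he' hy hy', map_add]
  ring

theorem laplacianInChart_eq (he : e ∈ atlas (Euc n) F) (he' : e' ∈ atlas (Euc n) F)
    {f : F → ℝ} (hf : ContMDiff (𝓡 n) 𝓘(ℝ, ℝ) 2 f) {x : F} (hx : x ∈ e.source)
    (hx' : x ∈ e'.source) :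
    laplacianInChart g e f (e x) = laplacianInChart g e' f (e' x) := by
  have hy : e x ∈ e.target := e.map_source hx
  have hxy : e.symm (e x) = x := e.left_inv hx
  have hy' : e.symm (e x) ∈ e'.source := hxy.symm ▸ hx'
  rw [laplacianInChart_eq_chartTrace g e (differentiableAt_fderiv_comp_symm he hy (hf _)),
    laplacianInChart_eq_chartTrace g e'
      (differentiableAt_fderiv_comp_symm he' (e'.map_source hx') (hf _)),
    chartHessian_transition g he he' hf hy hy', chartTrace_transition g he he' hy hy', hxy]

/-- The inner product of the gradients of `a` and `b` in the chart `e`. -/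
def gradInnerInChart (e : OpenPartialHomeomorph F (Euc n)) (a b : F → ℝ) (y : Euc n) : ℝ :=
  chartTrace g e y ((fderiv ℝ (a ∘ e.symm) y).smulRight (fderiv ℝ (b ∘ e.symm) y))

/-- The inner product `⟨∇ a, ∇ b⟩`, computed at each point in the preferred chart. -/
def gradInner (a b : F → ℝ) (x : F) : ℝ :=
  gradInnerInChart g (chartAt (Euc n) x) a b (chartAt (Euc n) x x)

theorem gradInnerInChart_eq (he : e ∈ atlas (Euc n) F) (he' : e' ∈ atlas (Euc n) F)
    {a b : F → ℝ} (ha : ContMDiff (𝓡 n) 𝓘(ℝ, ℝ) 1 a) (hb : ContMDiff (𝓡 n) 𝓘(ℝ, ℝ) 1 b)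
    {x : F} (hx : x ∈ e.source) (hx' : x ∈ e'.source) :
    gradInnerInChart g e a b (e x) = gradInnerInChart g e' a b (e' x) := by
  have hy : e x ∈ e.target := e.map_source hx
  have hxy : e.symm (e x) = x := e.left_inv hx
  have hy' : e.symm (e x) ∈ e'.source := hxy.symm ▸ hx'
  rw [gradInnerInChart, gradInnerInChart, ← hxy, e.right_inv hy,
    ← chartTrace_transition g he he' hy hy',
    fderiv_comp_symm_transition he he' ha hy hy', fderiv_comp_symm_transition he he' hb hy hy']
  rfl

end Transition

/-! ### Continuity of the Laplacian and of the inner product of gradients -/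

section Continuity

variable {n : ℕ} {F : Type*} [TopologicalSpace F]
  [ChartedSpace (EuclideanSpace ℝ (Fin n)) F] [IsManifold (𝓡 n) ∞ F] (g : SmoothMetric n F)
  {e : OpenPartialHomeomorph F (Euc n)}

theorem continuousOn_invMetric (he : e ∈ atlas (Euc n) F) (i j : Fin n) :
    ContinuousOn (invMetric g e i j) e.target := by
  have hG : ContinuousOn (metricMatrix g e) e.target :=
    continuousOn_pi.2 fun i => continuousOn_pi.2 fun j =>
      ((contDiffOn_chartMetric g he).continuousOn.clm_apply continuousOn_const).clm_apply
        continuousOn_const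
  intro y hy
  have hinv : ContinuousAt (Ring.inverse : ℝ → ℝ) (metricMatrix g e y).det := by
    rw [Ring.inverse_eq_inv']
    exact continuousAt_inv₀ (isUnit_det_metricMatrix g he hy).ne_zero
  exact (continuous_apply_apply i j).continuousAt.comp_continuousWithinAt
    ((continuousAt_matrix_inv _ hinv).comp_continuousWithinAt (hG y hy))

theorem continuousOn_chartTrace (he : e ∈ atlas (Euc n) F)
    {β : Euc n → Euc n →L[ℝ] Euc n →L[ℝ] ℝ}
    (hβ : ∀ u v, ContinuousOn (fun y => β y u v) e.target) :
    ContinuousOn (fun y => chartTrace g e y (β y)) e.target := by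
  simp only [chartTrace_apply]
  exact continuousOn_finsetSum _ fun i _ => continuousOn_finsetSum _ fun j _ =>
    (continuousOn_invMetric g he i j).mul (hβ _ _)

theorem continuousOn_christoffelMap (he : e ∈ atlas (Euc n) F) (u v : Euc n) :
    ContinuousOn (fun y => christoffelMap g e y u v) e.target := by
  have hmetric : ContinuousOn (fderiv ℝ (chartMetric g e)) e.target :=
    (contDiffOn_chartMetric g he).continuousOn_fderiv_of_isOpen e.open_target (by simp)
  have hsymbol (k i j : Fin n) : ContinuousOn (christoffel g e k i j) e.target := by
    refine ContinuousOn.congr ?_ fun y hy => christoffel_eq_sum_koszul g he hy k i j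
    simp only [koszul_apply]
    exact continuousOn_finsetSum _ fun l _ => (continuousOn_invMetric g he k l).mul (by fun_prop)
  simp only [christoffelMap, _root_.sum_apply, ContinuousLinearMap.smulRight_apply,
    _root_.smul_apply]
  fun_prop

theorem continuousOn_laplacianInChart (he : e ∈ atlas (Euc n) F) {f : F → ℝ}
    (hf : ContMDiff (𝓡 n) 𝓘(ℝ, ℝ) 2 f) : ContinuousOn (laplacianInChart g e f) e.target := by
  have hfe := contDiffOn_comp_symm he hf
  have hdf : ContDiffOn ℝ 1 (fderiv ℝ (f ∘ e.symm)) e.target :=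
    hfe.fderiv_of_isOpen e.open_target le_rfl
  have hd : ContinuousOn (fderiv ℝ (f ∘ e.symm)) e.target := hdf.continuousOn
  have hdd : ContinuousOn (fderiv ℝ (fderiv ℝ (f ∘ e.symm))) e.target :=
    hdf.continuousOn_fderiv_of_isOpen e.open_target le_rfl
  refine (continuousOn_chartTrace g he fun u v => ?_).congr
    fun y hy => laplacianInChart_eq_chartTrace g e (differentiableAt_fderiv_comp_symm he hy (hf _))
  simp only [chartHessian_apply]
  exact ((hdd.clm_apply continuousOn_const).clm_apply continuousOn_const).sub
    (hd.clm_apply (continuousOn_christoffelMap g he u v))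

theorem continuousOn_gradInnerInChart (he : e ∈ atlas (Euc n) F) {a b : F → ℝ}
    (ha : ContMDiff (𝓡 n) 𝓘(ℝ, ℝ) 1 a) (hb : ContMDiff (𝓡 n) 𝓘(ℝ, ℝ) 1 b) :
    ContinuousOn (gradInnerInChart g e a b) e.target := by
  have hd {f : F → ℝ} (hf : ContMDiff (𝓡 n) 𝓘(ℝ, ℝ) 1 f) :
      ContinuousOn (fderiv ℝ (f ∘ e.symm)) e.target :=
    (contDiffOn_comp_symm he hf).continuousOn_fderiv_of_isOpen e.open_target le_rfl
  refine continuousOn_chartTrace g he fun u v => ?_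
  exact ((hd ha).clm_apply continuousOn_const).smul ((hd hb).clm_apply continuousOn_const)

theorem continuous_of_continuousOn_charts {H X Y : Type*} [TopologicalSpace H]
    [TopologicalSpace X] [ChartedSpace H X] [TopologicalSpace Y]
    {Q : OpenPartialHomeomorph X H → H → Y}
    (hQ : ∀ e ∈ atlas H X, ∀ e' ∈ atlas H X, ∀ x ∈ e.source, x ∈ e'.source →
      Q e (e x) = Q e' (e' x))
    (hc : ∀ e ∈ atlas H X, ContinuousOn (Q e) e.target) :
    Continuous fun x => Q (chartAt H x) (chartAt H x x) := by
  refine continuous_iff_continuousAt.2 fun p => ?_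
  have hp := mem_chart_source H p
  have hcomp : ContinuousAt (fun x => Q (chartAt H p) (chartAt H p x)) p :=
    ((hc _ (chart_mem_atlas H p)).continuousAt (chart_target_mem_nhds H p)).comp
      ((chartAt H p).continuousAt hp)
  refine hcomp.congr ?_
  filter_upwards [chart_source_mem_nhds H p] with x hx
  exact hQ _ (chart_mem_atlas H p) _ (chart_mem_atlas H x) x hx (mem_chart_source H x)

theorem continuous_laplacian {f : F → ℝ} (hf : ContMDiff (𝓡 n) 𝓘(ℝ, ℝ) 2 f) :
    Continuous (laplacian g f) :=
  continuous_of_continuousOn_charts (Q := fun e => laplacianInChart g e f)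
    (fun _ he _ he' _ hx hx' => laplacianInChart_eq g he he' hf hx hx')
    fun _ he => continuousOn_laplacianInChart g he hf

theorem continuous_gradInner {a b : F → ℝ} (ha : ContMDiff (𝓡 n) 𝓘(ℝ, ℝ) 1 a)
    (hb : ContMDiff (𝓡 n) 𝓘(ℝ, ℝ) 1 b) : Continuous (gradInner g a b) :=
  continuous_of_continuousOn_charts (Q := fun e => gradInnerInChart g e a b)
    (fun _ he _ he' _ hx hx' => gradInnerInChart_eq g he he' ha hb hx hx')
    fun _ he => continuousOn_gradInnerInChart g he ha hb

end Continuity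

/-! ### A smooth concave replacement of `s ↦ min s 0` -/

section SmoothMin

open intervalIntegral

theorem hasDerivAt_expNegInvGlue (x : ℝ) :
    HasDerivAt expNegInvGlue (x⁻¹ ^ 2 * expNegInvGlue x) x := by
  simpa using expNegInvGlue.hasDerivAt_polynomial_eval_inv_mul 1 x

/-- The function `k` supported in `[-1, 1]` for which the bump function `exp (-1 / (1 - s²))` has
derivative `-s k(s)`. -/
def bumpDensity (s : ℝ) : ℝ :=
  2 * ((1 - s ^ 2)⁻¹ ^ 2 * expNegInvGlue (1 - s ^ 2))

theorem one_sub_sq_nonpos {s : ℝ} (hs : 1 ≤ |s|) : 1 - s ^ 2 ≤ 0 :=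
  sub_nonpos.2 ((one_le_sq_iff_one_le_abs s).2 hs)

theorem contDiff_bumpDensity : ContDiff ℝ ∞ bumpDensity := by
  have h := (expNegInvGlue.contDiff_polynomial_eval_inv_mul (n := ⊤) (Polynomial.X ^ 2)).comp
    (f := fun s : ℝ => 1 - s ^ 2) (by fun_prop)
  simp only [Polynomial.eval_pow, Polynomial.eval_X] at h
  exact contDiff_const.mul h

theorem bumpDensity_nonneg (s : ℝ) : 0 ≤ bumpDensity s :=
  mul_nonneg zero_le_two (mul_nonneg (sq_nonneg _) (expNegInvGlue.nonneg _))

theorem bumpDensity_eq_zero {s : ℝ} (hs : 1 ≤ |s|) : bumpDensity s = 0 := by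
  rw [bumpDensity, expNegInvGlue.zero_of_nonpos (one_sub_sq_nonpos hs), mul_zero, mul_zero]

theorem expNegInvGlue_le_bumpDensity (s : ℝ) : expNegInvGlue (1 - s ^ 2) ≤ bumpDensity s := by
  rcases le_or_gt (1 - s ^ 2) 0 with hs | hs
  · exact (expNegInvGlue.zero_of_nonpos hs).trans_le (bumpDensity_nonneg s)
  · have hinv : 1 ≤ (1 - s ^ 2)⁻¹ ^ 2 :=
      one_le_pow₀ ((one_le_inv₀ hs).2 (sub_le_self 1 (sq_nonneg s)))
    have hmul := le_mul_of_one_le_left (expNegInvGlue.nonneg (1 - s ^ 2)) hinv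
    rw [bumpDensity]
    linarith [expNegInvGlue.nonneg (1 - s ^ 2)]

/-- The total mass of `bumpDensity`. -/
def bumpMass : ℝ :=
  ∫ t in (-1)..1, bumpDensity t

theorem bumpMass_pos : 0 < bumpMass := by
  refine intervalIntegral_pos_of_pos_on (contDiff_bumpDensity.continuous.intervalIntegrable _ _)
    (fun s hs => ?_) (by norm_num)
  have hs' : 0 < 1 - s ^ 2 := sub_pos.2 ((sq_lt_one_iff_abs_lt_one s).2 (abs_lt.2 hs))
  have hexp := expNegInvGlue.pos_of_pos hs'
  rw [bumpDensity]
  positivity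

/-- Minus the second derivative of `smoothMin`. -/
def smoothMinDensity (s : ℝ) : ℝ :=
  bumpMass⁻¹ * bumpDensity s

/-- The derivative of `smoothMin`. -/
def smoothMinSlope (s : ℝ) : ℝ :=
  ∫ t in s..1, smoothMinDensity t

/-- The defect `s w - η` of `η = smoothMin`, with derivative `w`, from being homogeneous of
degree one. -/
def smoothMinDefect (s : ℝ) : ℝ :=
  bumpMass⁻¹ * expNegInvGlue (1 - s ^ 2)

/-- A smooth concave function that agrees with `s ↦ min s 0` for `1 ≤ |s|`. -/
def smoothMin (s : ℝ) : ℝ :=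
  s * smoothMinSlope s - smoothMinDefect s

theorem continuous_smoothMinDensity : Continuous smoothMinDensity :=
  continuous_const.mul contDiff_bumpDensity.continuous

theorem smoothMinDensity_nonneg (s : ℝ) : 0 ≤ smoothMinDensity s :=
  mul_nonneg (inv_nonneg.2 bumpMass_pos.le) (bumpDensity_nonneg s)

theorem smoothMinDensity_eq_zero {s : ℝ} (hs : 1 ≤ |s|) : smoothMinDensity s = 0 := by
  rw [smoothMinDensity, bumpDensity_eq_zero hs, mul_zero]

theorem hasDerivAt_smoothMinSlope (s : ℝ) :
    HasDerivAt smoothMinSlope (-smoothMinDensity s) s :=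
  integral_hasDerivAt_left (continuous_smoothMinDensity.intervalIntegrable s 1)
    (continuous_smoothMinDensity.stronglyMeasurableAtFilter _ _)
    continuous_smoothMinDensity.continuousAt

theorem hasDerivAt_smoothMinDefect (s : ℝ) :
    HasDerivAt smoothMinDefect (-(s * smoothMinDensity s)) s := by
  have hpoly : HasDerivAt (fun s : ℝ => 1 - s ^ 2) (-(2 * s)) s := by
    simpa using (hasDerivAt_pow 2 s).const_sub 1
  refine (((hasDerivAt_expNegInvGlue (1 - s ^ 2)).comp s hpoly).const_mul _).congr_deriv ?_
  rw [smoothMinDensity, bumpDensity]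
  ring

theorem hasDerivAt_smoothMin (s : ℝ) : HasDerivAt smoothMin (smoothMinSlope s) s := by
  refine (((hasDerivAt_id s).mul (hasDerivAt_smoothMinSlope s)).sub
    (hasDerivAt_smoothMinDefect s)).congr_deriv ?_
  rw [id_eq]
  ring

theorem contDiff_smoothMin : ContDiff ℝ ∞ smoothMin := by
  have hslope : ContDiff ℝ ∞ smoothMinSlope := by
    rw [contDiff_infty_iff_deriv, funext fun s => (hasDerivAt_smoothMinSlope s).deriv]
    exact ⟨fun s => (hasDerivAt_smoothMinSlope s).differentiableAt,
      (contDiff_const.mul contDiff_bumpDensity).neg⟩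
  rw [contDiff_infty_iff_deriv, funext fun s => (hasDerivAt_smoothMin s).deriv]
  exact ⟨fun s => (hasDerivAt_smoothMin s).differentiableAt, hslope⟩

theorem smoothMinSlope_of_one_le {s : ℝ} (hs : 1 ≤ s) : smoothMinSlope s = 0 := by
  rw [smoothMinSlope, integral_congr (g := fun _ => (0 : ℝ)), integral_zero]
  intro t ht
  rw [uIcc_of_ge hs] at ht
  exact smoothMinDensity_eq_zero (le_abs.2 (Or.inl ht.1))

theorem smoothMinSlope_of_le_neg_one {s : ℝ} (hs : s ≤ -1) : smoothMinSlope s = 1 := by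
  have hleft : ∫ t in s..(-1), smoothMinDensity t = 0 := by
    rw [integral_congr (g := fun _ => (0 : ℝ)), integral_zero]
    intro t ht
    rw [uIcc_of_le hs] at ht
    exact smoothMinDensity_eq_zero (le_abs.2 (Or.inr (le_neg_of_le_neg ht.2)))
  rw [smoothMinSlope, ← integral_add_adjacent_intervals
    (continuous_smoothMinDensity.intervalIntegrable s (-1))
    (continuous_smoothMinDensity.intervalIntegrable (-1) 1), hleft, zero_add]
  exact (integral_const_mul _ _).trans (inv_mul_cancel₀ bumpMass_pos.ne')

theorem smoothMinSlope_nonneg (s : ℝ) : 0 ≤ smoothMinSlope s :=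
  (smoothMinSlope_of_one_le (le_max_right s 1)).symm.trans_le <|
    antitone_of_hasDerivAt_nonpos hasDerivAt_smoothMinSlope
      (fun t => neg_nonpos.2 (smoothMinDensity_nonneg t)) (le_max_left s 1)

theorem smoothMinDefect_nonneg (s : ℝ) : 0 ≤ smoothMinDefect s :=
  mul_nonneg (inv_nonneg.2 bumpMass_pos.le) (expNegInvGlue.nonneg _)

theorem smoothMinDefect_eq_zero {s : ℝ} (hs : 1 ≤ |s|) : smoothMinDefect s = 0 := by
  rw [smoothMinDefect, expNegInvGlue.zero_of_nonpos (one_sub_sq_nonpos hs), mul_zero]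

theorem smoothMinDefect_le_density (s : ℝ) : smoothMinDefect s ≤ smoothMinDensity s :=
  mul_le_mul_of_nonneg_left (expNegInvGlue_le_bumpDensity s) (inv_nonneg.2 bumpMass_pos.le)

theorem smoothMinDefect_le_one_sub_slope (s : ℝ) : smoothMinDefect s ≤ 1 - smoothMinSlope s := by
  have hmono : Monotone fun t => 1 - smoothMinSlope t - smoothMinDefect t := by
    refine monotone_of_hasDerivAt_nonneg (f' := fun t => (1 + t) * smoothMinDensity t)
      (fun t => (((hasDerivAt_smoothMinSlope t).const_sub 1).sub
        (hasDerivAt_smoothMinDefect t)).congr_deriv (by ring)) fun t => ?_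
    rcases le_or_gt t (-1) with ht | ht
    · exact (mul_eq_zero_of_right _
        (smoothMinDensity_eq_zero (le_abs.2 (Or.inr (le_neg_of_le_neg ht))))).ge
    · exact mul_nonneg (neg_le_iff_add_nonneg'.1 ht.le) (smoothMinDensity_nonneg t)
  have hle : min s (-1) ≤ -1 := min_le_right s (-1)
  have h := hmono (min_le_left s (-1))
  simp only [smoothMinSlope_of_le_neg_one hle,
    smoothMinDefect_eq_zero (le_abs.2 (Or.inr (le_neg_of_le_neg hle)))] at h
  linarith

theorem smoothMin_of_one_le {s : ℝ} (hs : 1 ≤ s) : smoothMin s = 0 := by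
  rw [smoothMin, smoothMinSlope_of_one_le hs, smoothMinDefect_eq_zero (le_abs.2 (Or.inl hs)),
    mul_zero, sub_zero]

theorem smoothMin_of_le_neg_one {s : ℝ} (hs : s ≤ -1) : smoothMin s = s := by
  rw [smoothMin, smoothMinSlope_of_le_neg_one hs,
    smoothMinDefect_eq_zero (le_abs.2 (Or.inr (le_neg_of_le_neg hs))), mul_one, sub_zero]

end SmoothMin

/-! ### Small positive functions -/

theorem bddAbove_image_of_eventually_le {X α : Type*} [TopologicalSpace X] [Preorder α]
    [Nonempty α] [IsDirectedOrder α] {K : Set X} (hK : IsCompact K) {q : X → α}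
    (hq : ∀ p ∈ K, ∃ C, ∀ᶠ x in 𝓝 p, q x ≤ C) : BddAbove (q '' K) := by
  refine hK.induction_on (p := fun s => BddAbove (q '' s)) (by simp)
    (fun s t hst ht => ht.mono (image_mono hst)) (fun s t hs ht => ?_) fun p hp => ?_
  · rw [image_union]
    exact hs.union ht
  · obtain ⟨C, hC⟩ := hq p hp
    exact ⟨_, mem_nhdsWithin_of_mem_nhds hC, C, forall_mem_image.2 fun _ => id⟩

section SmallFunctions

variable {E H X : Type*} [NormedAddCommGroup E] [NormedSpace ℝ E] [TopologicalSpace H]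
  {I : ModelWithCorners ℝ E H} [TopologicalSpace X] [ChartedSpace H X]

/-- `D a p` measures the size of the germ of the smooth function `a` at `p`: it is subadditive and
positively homogeneous in `a`, and locally bounded above in `p`. The model case is a sum of absolute
values of linear differential operators applied to `a`. -/
structure IsLocalSublinear (I : ModelWithCorners ℝ E H) (D : (X → ℝ) → X → ℝ) : Prop where
  add_le : ∀ {a b : X → ℝ}, ContMDiff I 𝓘(ℝ, ℝ) ∞ a → ContMDiff I 𝓘(ℝ, ℝ) ∞ b →
    ∀ p, D (a + b) p ≤ D a p + D b p
  smul_le : ∀ {c : ℝ} {a : X → ℝ}, 0 ≤ c → ContMDiff I 𝓘(ℝ, ℝ) ∞ a → ∀ p, D (c • a) p ≤ c * D a p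
  congr : ∀ {a b : X → ℝ} {p : X}, a =ᶠ[𝓝 p] b → D a p = D b p
  eventually_le : ∀ {a : X → ℝ}, ContMDiff I 𝓘(ℝ, ℝ) ∞ a → ∀ p, ∃ C, ∀ᶠ x in 𝓝 p, D a x ≤ C

namespace IsLocalSublinear

variable {D : (X → ℝ) → X → ℝ} {ε : X → ℝ}

theorem add {D₁ D₂ : (X → ℝ) → X → ℝ} (h₁ : IsLocalSublinear I D₁) (h₂ : IsLocalSublinear I D₂) :
    IsLocalSublinear I (D₁ + D₂) where
  add_le ha hb p := (add_le_add (h₁.add_le ha hb p) (h₂.add_le ha hb p)).trans_eq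
    (add_add_add_comm _ _ _ _)
  smul_le hc ha p := (add_le_add (h₁.smul_le hc ha p) (h₂.smul_le hc ha p)).trans_eq
    (mul_add _ _ _).symm
  congr h := congrArg₂ (· + ·) (h₁.congr h) (h₂.congr h)
  eventually_le ha p :=
    let ⟨C₁, hC₁⟩ := h₁.eventually_le ha p
    let ⟨C₂, hC₂⟩ := h₂.eventually_le ha p
    ⟨C₁ + C₂, hC₁.mp (hC₂.mono fun _ hx₂ hx₁ => add_le_add hx₁ hx₂)⟩

theorem abs_linear {L : (X → ℝ) → X → ℝ}
    (hadd : ∀ {a b}, ContMDiff I 𝓘(ℝ, ℝ) ∞ a → ContMDiff I 𝓘(ℝ, ℝ) ∞ b →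
      ∀ p, L (a + b) p = L a p + L b p)
    (hsmul : ∀ (c : ℝ) {a}, ContMDiff I 𝓘(ℝ, ℝ) ∞ a → ∀ p, L (c • a) p = c * L a p)
    (hcongr : ∀ {a b p}, a =ᶠ[𝓝 p] b → L a p = L b p)
    (hcont : ∀ {a}, ContMDiff I 𝓘(ℝ, ℝ) ∞ a → Continuous (L a)) :
    IsLocalSublinear I fun a p => |L a p| where
  add_le ha hb p := (congrArg abs (hadd ha hb p)).trans_le (abs_add_le _ _)
  smul_le hc ha p := by rw [hsmul _ ha, abs_mul, abs_of_nonneg hc]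
  congr h := congrArg abs (hcongr h)
  eventually_le {a} ha p := ⟨|L a p| + 1,
    ((hcont ha).abs.continuousAt.eventually (gt_mem_nhds (lt_add_one _))).mono fun _ => le_of_lt⟩

theorem zero_le (hD : IsLocalSublinear I D) (p : X) : D 0 p ≤ 0 := by
  simpa using hD.smul_le le_rfl contMDiff_const (a := 0) p

theorem sum_le (hD : IsLocalSublinear I D) {ι : Type*} {a : ι → X → ℝ}
    (ha : ∀ i, ContMDiff I 𝓘(ℝ, ℝ) ∞ (a i)) (s : Finset ι) (p : X) :
    D (∑ i ∈ s, a i) p ≤ ∑ i ∈ s, D (a i) p :=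
  Finset.le_sum_of_subadditive_on_pred (fun b => D b p) (ContMDiff I 𝓘(ℝ, ℝ) ∞) (hD.zero_le p)
    (fun _ _ hb hc => hD.add_le hb hc p) (fun _ _ hb hc => hb.add hc) a fun i _ => ha i

theorem exists_pos_smul_le (hD : IsLocalSublinear I D) {a : X → ℝ} (ha : ContMDiff I 𝓘(ℝ, ℝ) ∞ a)
    (hsupp : HasCompactSupport a) (hε : ∀ p, ∃ c > 0, ∀ᶠ x in 𝓝 p, c ≤ ε x) :
    ∃ c : ℝ, 0 < c ∧ ∀ p, D (c • a) p ≤ ε p := by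
  have hεpos (p) : 0 < ε p := let ⟨_, hc, h⟩ := hε p; hc.trans_le h.self_of_nhds
  have hlocal : ∀ p ∈ tsupport a, ∃ C, ∀ᶠ x in 𝓝 p, D a x / ε x ≤ C := fun p _ => by
    obtain ⟨C, hC⟩ := hD.eventually_le ha p
    obtain ⟨c, hc, hcε⟩ := hε p
    refine ⟨max C 0 / c, ?_⟩
    filter_upwards [hC, hcε] with x hx hx'
    exact div_le_div₀ (le_max_right C 0) (hx.trans (le_max_left C 0)) hc hx'
  obtain ⟨B, hB⟩ := bddAbove_image_of_eventually_le hsupp.isCompact hlocal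
  have hBpos : 0 < max B 1 := lt_max_of_lt_right one_pos
  refine ⟨(max B 1)⁻¹, inv_pos.2 hBpos, fun p =>
    (hD.smul_le (inv_pos.2 hBpos).le ha p).trans ((inv_mul_le_iff₀ hBpos).2 ?_)⟩
  by_cases hp : p ∈ tsupport a
  · exact ((div_le_iff₀ (hεpos p)).1 (hB (mem_image_of_mem _ hp))).trans
      (mul_le_mul_of_nonneg_right (le_max_left B 1) (hεpos p).le)
  · rw [hD.congr (notMem_tsupport_iff_eventuallyEq.1 hp)]
    exact (hD.zero_le p).trans (mul_pos hBpos (hεpos p)).le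

theorem exists_pos_contMDiff_le [FiniteDimensional ℝ E] [IsManifold I ∞ X] [T2Space X]
    [SigmaCompactSpace X] (hD : IsLocalSublinear I D)
    (hε : ∀ p, ∃ c > 0, ∀ᶠ x in 𝓝 p, c ≤ ε x) :
    ∃ δ : X → ℝ, ContMDiff I 𝓘(ℝ, ℝ) ∞ δ ∧ (∀ p, 0 < δ p) ∧ ∀ p, D δ p ≤ ε p := by
  obtain ⟨ι, ρ, -⟩ := SmoothBumpCovering.exists_isSubordinate I (s := (univ : Set X))
    isClosed_univ (U := fun _ => univ) fun _ _ => univ_mem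
  have hcount : (univ : Set ι).Countable :=
    ρ.locallyFinite.countable_univ fun i => ⟨ρ.c i, by simp⟩
  obtain ⟨θ, hθpos, hθsum⟩ := hcount.exists_pos_forall_sum_le one_pos
  have hscale (i) : ∃ c : ℝ, 0 < c ∧ ∀ p, D (c • ⇑(ρ i)) p ≤ θ i * ε p :=
    hD.exists_pos_smul_le (ρ i).contMDiff (ρ i).hasCompactSupport fun p =>
      let ⟨c, hc, h⟩ := hε p
      ⟨θ i * c, mul_pos (hθpos i) hc, h.mono fun _ hx => mul_le_mul_of_nonneg_left hx (hθpos i).le⟩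
  choose c hcpos hc using hscale
  have hsmooth (i) : ContMDiff I 𝓘(ℝ, ℝ) ∞ (c i • ⇑(ρ i)) :=
    ContMDiff.mul (I := 𝓘(ℝ, ℝ)) (I' := I) contMDiff_const (ρ i).contMDiff
  have hfinite : LocallyFinite fun i => Function.support (c i • ⇑(ρ i)) :=
    ρ.locallyFinite.subset fun i => Function.support_const_smul_subset _ _
  refine ⟨fun p => ∑ᶠ i, (c i • ⇑(ρ i)) p, contMDiff_finsum hsmooth hfinite, fun p => ?_,
    fun p => ?_⟩
  · refine finsum_pos (fun i => mul_nonneg (hcpos i).le (ρ i).nonneg)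
      ⟨ρ.ind p (mem_univ p), ?_⟩ (hfinite.point_finite p)
    rw [Pi.smul_apply, ρ.apply_ind, smul_eq_mul, mul_one]
    exact hcpos _
  · obtain ⟨s, hs⟩ := finsum_eventually_eq_sum hfinite p
    have hε0 : 0 ≤ ε p := let ⟨_, hc, h⟩ := hε p; hc.le.trans h.self_of_nhds
    calc D (fun x => ∑ᶠ i, (c i • ⇑(ρ i)) x) p
        = D (∑ i ∈ s, c i • ⇑(ρ i)) p :=
          hD.congr (hs.mono fun x hx => hx.trans (Finset.sum_apply x s _).symm)
      _ ≤ ∑ i ∈ s, D (c i • ⇑(ρ i)) p := hD.sum_le hsmooth s p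
      _ ≤ ∑ i ∈ s, θ i * ε p := Finset.sum_le_sum fun i _ => hc i p
      _ ≤ ε p := by
          rw [← Finset.sum_mul]
          exact mul_le_of_le_one_left hε0 (hθsum s (subset_univ _))

end IsLocalSublinear

end SmallFunctions

/-! ### Calculus of the Laplacian and of gradients -/

section SecondDerivative

variable {𝕜 E : Type*} [NontriviallyNormedField 𝕜] [NormedAddCommGroup E] [NormedSpace 𝕜 E]
  {a b : E → 𝕜} {y : E}

theorem hasFDerivAt_fderiv (ha : ContDiffAt 𝕜 2 a y) :
    HasFDerivAt (fderiv 𝕜 a) (fderiv 𝕜 (fderiv 𝕜 a) y) y :=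
  ((ha.fderiv_right (m := 1) le_rfl).differentiableAt one_ne_zero).hasFDerivAt

theorem eventually_differentiableAt (ha : ContDiffAt 𝕜 2 a y) :
    ∀ᶠ z in 𝓝 y, DifferentiableAt 𝕜 a z :=
  (ha.eventually (by simp)).mono fun _ hz => hz.differentiableAt two_ne_zero

theorem hasFDerivAt_fderiv_add (ha : ContDiffAt 𝕜 2 a y) (hb : ContDiffAt 𝕜 2 b y) :
    HasFDerivAt (fderiv 𝕜 (a + b)) (fderiv 𝕜 (fderiv 𝕜 a) y + fderiv 𝕜 (fderiv 𝕜 b) y) y :=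
  ((hasFDerivAt_fderiv ha).add (hasFDerivAt_fderiv hb)).congr_of_eventuallyEq <| by
    filter_upwards [eventually_differentiableAt ha, eventually_differentiableAt hb] with z hza hzb
    exact fderiv_add hza hzb

theorem hasFDerivAt_fderiv_mul (ha : ContDiffAt 𝕜 2 a y) (hb : ContDiffAt 𝕜 2 b y) :
    HasFDerivAt (fderiv 𝕜 (a * b))
      (a y • fderiv 𝕜 (fderiv 𝕜 b) y + (fderiv 𝕜 a y).smulRight (fderiv 𝕜 b y)
        + (b y • fderiv 𝕜 (fderiv 𝕜 a) y + (fderiv 𝕜 b y).smulRight (fderiv 𝕜 a y))) y :=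
  (((ha.differentiableAt two_ne_zero).hasFDerivAt.smul (hasFDerivAt_fderiv hb)).add
    ((hb.differentiableAt two_ne_zero).hasFDerivAt.smul
      (hasFDerivAt_fderiv ha))).congr_of_eventuallyEq <| by
    filter_upwards [eventually_differentiableAt ha, eventually_differentiableAt hb] with z hza hzb
    exact fderiv_mul hza hzb

theorem hasFDerivAt_fderiv_comp {ψ ψ' : 𝕜 → 𝕜} {c : 𝕜} (hψ : ∀ s, HasDerivAt ψ (ψ' s) s)
    (hψ' : HasDerivAt ψ' c (a y)) (ha : ContDiffAt 𝕜 2 a y) :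
    HasFDerivAt (fderiv 𝕜 (ψ ∘ a))
      (ψ' (a y) • fderiv 𝕜 (fderiv 𝕜 a) y + c • (fderiv 𝕜 a y).smulRight (fderiv 𝕜 a y)) y := by
  have hψa : fderiv 𝕜 (ψ ∘ a) =ᶠ[𝓝 y] fun z => ψ' (a z) • fderiv 𝕜 a z :=
    (eventually_differentiableAt ha).mono fun z hz =>
      ((hψ _).comp_hasFDerivAt z hz.hasFDerivAt).fderiv
  refine (((hψ'.comp_hasFDerivAt y (ha.differentiableAt two_ne_zero).hasFDerivAt).smul
    (hasFDerivAt_fderiv ha)).congr_of_eventuallyEq hψa).congr_fderiv ?_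
  ext u v
  simp [mul_assoc]

end SecondDerivative

section Calculus

variable {n : ℕ} {F : Type*} [TopologicalSpace F] [ChartedSpace (EuclideanSpace ℝ (Fin n)) F]

theorem eventuallyEq_comp_chartAt_symm {a b : F → ℝ} {p : F} (h : a =ᶠ[𝓝 p] b) :
    a ∘ (chartAt (Euc n) p).symm =ᶠ[𝓝 (chartAt (Euc n) p p)] b ∘ (chartAt (Euc n) p).symm :=
  h.comp_tendsto ((chartAt (Euc n) p).tendsto_symm (mem_chart_source _ p))

theorem comp_chartAt_symm_apply (a : F → ℝ) (p : F) :
    (a ∘ (chartAt (Euc n) p).symm) (chartAt (Euc n) p p) = a p :=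
  congrArg a ((chartAt (Euc n) p).left_inv (mem_chart_source _ p))

theorem contDiffAt_comp_chartAt_symm {k : WithTop ℕ∞} [IsManifold (𝓡 n) k F] {a : F → ℝ} {p : F}
    (ha : ContMDiffAt (𝓡 n) 𝓘(ℝ, ℝ) k a p) :
    ContDiffAt ℝ k (a ∘ (chartAt (Euc n) p).symm) (chartAt (Euc n) p p) :=
  contDiffAt_comp_symm (chart_mem_atlas _ p) (mem_chart_target _ p)
    (by rwa [(chartAt (Euc n) p).left_inv (mem_chart_source _ p)])

theorem differentiableAt_comp_chartAt_symm [IsManifold (𝓡 n) 1 F] {a : F → ℝ} {p : F}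
    (ha : MDifferentiableAt (𝓡 n) 𝓘(ℝ, ℝ) a p) :
    DifferentiableAt ℝ (a ∘ (chartAt (Euc n) p).symm) (chartAt (Euc n) p p) := by
  rw [← (chartAt (Euc n) p).left_inv (mem_chart_source _ p)] at ha
  exact (ha.comp _ ((mdifferentiable_chart p).mdifferentiableAt_symm
    (mem_chart_target _ p))).differentiableAt

theorem dirDeriv_add {a b : F → ℝ} {p : F} (ha : MDifferentiableAt (𝓡 n) 𝓘(ℝ, ℝ) a p)
    (hb : MDifferentiableAt (𝓡 n) 𝓘(ℝ, ℝ) b p) (v : TangentSpace (𝓡 n) p) :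
    dirDeriv (a + b) p v = dirDeriv a p v + dirDeriv b p v := by
  rw [dirDeriv, mfderiv_add ha hb]
  rfl

theorem dirDeriv_mul {a b : F → ℝ} {p : F} (ha : MDifferentiableAt (𝓡 n) 𝓘(ℝ, ℝ) a p)
    (hb : MDifferentiableAt (𝓡 n) 𝓘(ℝ, ℝ) b p) (v : TangentSpace (𝓡 n) p) :
    dirDeriv (a * b) p v = a p * dirDeriv b p v + b p * dirDeriv a p v := by
  rw [dirDeriv, (ha.hasMFDerivAt.mul hb.hasMFDerivAt).mfderiv]
  rfl

theorem dirDeriv_eq_fderiv_comp_chartAt [IsManifold (𝓡 n) 1 F] {a : F → ℝ} {p : F}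
    (ha : MDifferentiableAt (𝓡 n) 𝓘(ℝ, ℝ) a p) (v : TangentSpace (𝓡 n) p) :
    dirDeriv a p v = fderiv ℝ (a ∘ (chartAt (Euc n) p).symm) (chartAt (Euc n) p p)
      (mfderiv (𝓡 n) (𝓡 n) (chartAt (Euc n) p) p v) := by
  have hchart : a =ᶠ[𝓝 p] (a ∘ (chartAt (Euc n) p).symm) ∘ chartAt (Euc n) p := by
    filter_upwards [(chartAt (Euc n) p).eventually_left_inverse (mem_chart_source _ p)] with q hq
    rw [Function.comp_apply, Function.comp_apply, hq]
  rw [dirDeriv, hchart.mfderiv_eq, mfderiv_comp p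
    (differentiableAt_comp_chartAt_symm ha).mdifferentiableAt
    ((mdifferentiable_chart p).mdifferentiableAt (mem_chart_source _ p)), mfderiv_eq_fderiv]
  rfl

variable [IsManifold (𝓡 n) ∞ F] (g : SmoothMetric n F) {a b c : F → ℝ} {p : F}

theorem laplacian_congr (h : a =ᶠ[𝓝 p] b) : laplacian g a p = laplacian g b p := by
  have hpderiv (j) : pderiv j (a ∘ (chartAt (Euc n) p).symm)
      =ᶠ[𝓝 (chartAt (Euc n) p p)] pderiv j (b ∘ (chartAt (Euc n) p).symm) :=
    ((eventuallyEq_comp_chartAt_symm h).fderiv (𝕜 := ℝ)).mono fun z hz => by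
      simp only [pderiv, hz]
  have hpderiv₂ (i j) : pderiv i (pderiv j (a ∘ (chartAt (Euc n) p).symm)) (chartAt (Euc n) p p)
      = pderiv i (pderiv j (b ∘ (chartAt (Euc n) p).symm)) (chartAt (Euc n) p p) := by
    rw [pderiv, (hpderiv j).fderiv_eq, ← pderiv]
  simp only [laplacian, laplacianInChart, hpderiv₂, fun j => (hpderiv j).self_of_nhds]

theorem gradInner_comm (a b : F → ℝ) (p : F) : gradInner g a b p = gradInner g b a p :=
  chartTrace_smulRight_comm g _ _ _ _

theorem laplacian_eq_of_hasFDerivAt {B : Euc n →L[ℝ] Euc n →L[ℝ] ℝ}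
    (h : HasFDerivAt (fderiv ℝ (a ∘ (chartAt (Euc n) p).symm)) B (chartAt (Euc n) p p)) :
    laplacian g a p = chartTrace g (chartAt (Euc n) p) (chartAt (Euc n) p p) (B
      - ContinuousLinearMap.compL ℝ (Euc n) (Euc n) ℝ
          (fderiv ℝ (a ∘ (chartAt (Euc n) p).symm) (chartAt (Euc n) p p))
        ∘L christoffelMap g (chartAt (Euc n) p) (chartAt (Euc n) p p)) := by
  rw [laplacian, laplacianInChart_eq_chartTrace g _ h.differentiableAt, chartHessian, h.fderiv]

theorem laplacian_add (ha : ContMDiffAt (𝓡 n) 𝓘(ℝ, ℝ) 2 a p)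
    (hb : ContMDiffAt (𝓡 n) 𝓘(ℝ, ℝ) 2 b p) :
    laplacian g (a + b) p = laplacian g a p + laplacian g b p := by
  have ha' := contDiffAt_comp_chartAt_symm ha
  have hb' := contDiffAt_comp_chartAt_symm hb
  have hab := hasFDerivAt_fderiv_add ha' hb'
  rw [laplacian_eq_of_hasFDerivAt g (a := a + b) hab,
    laplacian_eq_of_hasFDerivAt g (hasFDerivAt_fderiv ha'),
    laplacian_eq_of_hasFDerivAt g (hasFDerivAt_fderiv hb'), Pi.add_comp,
    fderiv_add (ha'.differentiableAt two_ne_zero) (hb'.differentiableAt two_ne_zero), map_add,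
    ContinuousLinearMap.add_comp, ← map_add, add_sub_add_comm]

theorem laplacian_mul (ha : ContMDiffAt (𝓡 n) 𝓘(ℝ, ℝ) 2 a p)
    (hb : ContMDiffAt (𝓡 n) 𝓘(ℝ, ℝ) 2 b p) :
    laplacian g (a * b) p =
      a p * laplacian g b p + b p * laplacian g a p + 2 * gradInner g a b p := by
  have ha' := contDiffAt_comp_chartAt_symm ha
  have hb' := contDiffAt_comp_chartAt_symm hb
  have hab := hasFDerivAt_fderiv_mul ha' hb'
  rw [laplacian_eq_of_hasFDerivAt g (a := a * b) hab,
    laplacian_eq_of_hasFDerivAt g (hasFDerivAt_fderiv ha'),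
    laplacian_eq_of_hasFDerivAt g (hasFDerivAt_fderiv hb'), Pi.mul_comp,
    fderiv_mul (ha'.differentiableAt two_ne_zero) (hb'.differentiableAt two_ne_zero)]
  simp only [map_add, map_smul, map_sub, ContinuousLinearMap.add_comp,
    ContinuousLinearMap.smul_comp, comp_chartAt_symm_apply, smul_eq_mul]
  rw [← gradInnerInChart, ← gradInnerInChart, ← gradInner, ← gradInner, gradInner_comm g b a]
  ring

theorem laplacian_comp {ψ ψ' : ℝ → ℝ} {ψ'' : ℝ} (hψ : ∀ s, HasDerivAt ψ (ψ' s) s)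
    (hψ' : HasDerivAt ψ' ψ'' (a p)) (ha : ContMDiffAt (𝓡 n) 𝓘(ℝ, ℝ) 2 a p) :
    laplacian g (ψ ∘ a) p = ψ' (a p) * laplacian g a p + ψ'' * gradInner g a a p := by
  have ha' := contDiffAt_comp_chartAt_symm ha
  have hψa := hasFDerivAt_fderiv_comp hψ (by rwa [comp_chartAt_symm_apply]) ha'
  have hderiv := ((hψ _).comp_hasFDerivAt _ (ha'.differentiableAt two_ne_zero).hasFDerivAt).fderiv
  rw [laplacian_eq_of_hasFDerivAt g (a := ψ ∘ a) hψa,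
    laplacian_eq_of_hasFDerivAt g (hasFDerivAt_fderiv ha'), Function.comp_assoc, hderiv]
  simp only [map_add, map_smul, map_sub, ContinuousLinearMap.smul_comp, comp_chartAt_symm_apply,
    smul_eq_mul, gradInner, gradInnerInChart]
  ring

theorem gradInner_congr_right (a : F → ℝ) (h : b =ᶠ[𝓝 p] c) :
    gradInner g a b p = gradInner g a c p := by
  rw [gradInner, gradInner, gradInnerInChart, gradInnerInChart,
    (eventuallyEq_comp_chartAt_symm h).fderiv_eq]

theorem gradInner_add_right (c : F → ℝ) (ha : MDifferentiableAt (𝓡 n) 𝓘(ℝ, ℝ) a p)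
    (hb : MDifferentiableAt (𝓡 n) 𝓘(ℝ, ℝ) b p) :
    gradInner g c (a + b) p = gradInner g c a p + gradInner g c b p := by
  rw [gradInner, gradInnerInChart, Pi.add_comp, fderiv_add (differentiableAt_comp_chartAt_symm ha)
    (differentiableAt_comp_chartAt_symm hb), chartTrace_smulRight_add]
  rfl

theorem gradInner_mul_right (c : F → ℝ) (ha : MDifferentiableAt (𝓡 n) 𝓘(ℝ, ℝ) a p)
    (hb : MDifferentiableAt (𝓡 n) 𝓘(ℝ, ℝ) b p) :
    gradInner g c (a * b) p = a p * gradInner g c b p + b p * gradInner g c a p := by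
  rw [gradInner, gradInnerInChart, Pi.mul_comp, fderiv_mul (differentiableAt_comp_chartAt_symm ha)
    (differentiableAt_comp_chartAt_symm hb), chartTrace_smulRight_add, chartTrace_smulRight_smul,
    chartTrace_smulRight_smul, comp_chartAt_symm_apply, comp_chartAt_symm_apply]
  rfl

theorem gradInner_comp_right (c : F → ℝ) {ψ : ℝ → ℝ} {ψ' : ℝ} (hψ : HasDerivAt ψ ψ' (a p))
    (ha : MDifferentiableAt (𝓡 n) 𝓘(ℝ, ℝ) a p) :
    gradInner g c (ψ ∘ a) p = ψ' * gradInner g c a p := by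
  have hψa := HasDerivAt.comp_hasFDerivAt (chartAt (Euc n) p p)
    (by rwa [comp_chartAt_symm_apply]) (differentiableAt_comp_chartAt_symm ha).hasFDerivAt
  rw [gradInner, gradInnerInChart, Function.comp_assoc, hψa.fderiv, chartTrace_smulRight_smul]
  rfl

theorem laplacian_const_smul (c : ℝ) (ha : ContMDiffAt (𝓡 n) 𝓘(ℝ, ℝ) 2 a p) :
    laplacian g (c • a) p = c * laplacian g a p := by
  have h := laplacian_comp g (ψ := (c * ·)) (ψ' := fun _ => c)
    (fun s => by simpa using (hasDerivAt_id s).const_mul c) (hasDerivAt_const _ c) ha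
  rwa [zero_mul, add_zero] at h

theorem gradInner_const_smul_right (c : F → ℝ) (r : ℝ) (ha : MDifferentiableAt (𝓡 n) 𝓘(ℝ, ℝ) a p) :
    gradInner g c (r • a) p = r * gradInner g c a p :=
  gradInner_comp_right g c (ψ := (r * ·)) (by simpa using (hasDerivAt_id (a p)).const_mul r) ha

theorem gradInner_self_pos (ha : MDifferentiableAt (𝓡 n) 𝓘(ℝ, ℝ) a p) {v : TangentSpace (𝓡 n) p}
    (hv : dirDeriv a p v ≠ 0) : 0 < gradInner g a a p := by
  refine chartTrace_smulRight_self_pos g (chart_mem_atlas _ p) (mem_chart_target _ p) fun h => hv ?_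
  rw [dirDeriv_eq_fderiv_comp_chartAt ha, h]
  rfl

theorem gradInner_self_nonneg (a : F → ℝ) (p : F) : 0 ≤ gradInner g a a p := by
  by_cases h : fderiv ℝ (a ∘ (chartAt (Euc n) p).symm) (chartAt (Euc n) p p) = 0
  · rw [gradInner, gradInnerInChart, h, ContinuousLinearMap.zero_smulRight, map_zero]
  · exact (chartTrace_smulRight_self_pos g (chart_mem_atlas _ p) (mem_chart_target _ p) h).le

end Calculus

/-! ### The sides of a regular level set -/

theorem isOpen_image_of_fst_eq {X Y Z : Type*} [TopologicalSpace X] [TopologicalSpace Y]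
    [TopologicalSpace Z] {Φ : OpenPartialHomeomorph X (Y × Z)} {u : X → Y}
    (hΦ : ∀ q ∈ Φ.source, (Φ q).1 = u q) {V : Set X} (hV : IsOpen V) (hVΦ : V ⊆ Φ.source) :
    IsOpen (u '' V) := by
  rw [← image_congr fun q hq => hΦ q (hVΦ hq), ← image_image Prod.fst Φ]
  exact isOpenMap_fst _ (Φ.isOpen_image_of_subset_source hV hVΦ)

theorem exists_isPreconnected_inter_preimage_of_fst_eq {X K : Type*} [TopologicalSpace X]
    [NormedAddCommGroup K] [NormedSpace ℝ K] {Φ : OpenPartialHomeomorph X (ℝ × K)} {u : X → ℝ}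
    (hΦ : ∀ q ∈ Φ.source, (Φ q).1 = u q) {p : X} (hp : p ∈ Φ.source) :
    ∃ U ⊆ Φ.source, IsOpen U ∧ p ∈ U ∧ ∀ S, Convex ℝ S → IsPreconnected (U ∩ u ⁻¹' S) := by
  obtain ⟨r, hr, hball⟩ := Metric.isOpen_iff.1 Φ.open_target _ (Φ.map_source hp)
  refine ⟨Φ.source ∩ Φ ⁻¹' Metric.ball (Φ p) r, inter_subset_left,
    Φ.isOpen_inter_preimage Metric.isOpen_ball, ⟨hp, Metric.mem_ball_self hr⟩, fun S hS => ?_⟩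
  have hconvex : Convex ℝ (Metric.ball (Φ p) r ∩ Prod.fst ⁻¹' S) :=
    (convex_ball _ _).inter (hS.linear_preimage (LinearMap.fst ℝ ℝ K))
  have himage : Φ.symm '' (Metric.ball (Φ p) r ∩ Prod.fst ⁻¹' S) =
      Φ.source ∩ Φ ⁻¹' Metric.ball (Φ p) r ∩ u ⁻¹' S := by
    rw [Φ.symm_image_eq_source_inter_preimage (inter_subset_left.trans hball)]
    ext q
    simp only [mem_inter_iff, mem_preimage, and_assoc]
    exact and_congr_right fun hq => by rw [hΦ q hq]
  rw [← himage]
  exact hconvex.isPreconnected.image _ (Φ.continuousOn_symm.mono (inter_subset_left.trans hball))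

section Sides

variable {n : ℕ} {F : Type*} [TopologicalSpace F] [ChartedSpace (EuclideanSpace ℝ (Fin n)) F]
  {u : F → ℝ} {p : F} {v : TangentSpace (𝓡 n) p}

theorem exists_straightening [IsManifold (𝓡 n) 1 F] (hu : ContMDiffAt (𝓡 n) 𝓘(ℝ, ℝ) 1 u p)
    (hv : dirDeriv u p v ≠ 0) :
    ∃ (K : Submodule ℝ (Euc n)) (Φ : OpenPartialHomeomorph F (ℝ × K)),
      p ∈ Φ.source ∧ ∀ q ∈ Φ.source, (Φ q).1 = u q := by
  have hstrict := (contDiffAt_comp_chartAt_symm hu).hasStrictFDerivAt one_ne_zero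
  have hrange : (fderiv ℝ (u ∘ (chartAt (Euc n) p).symm) (chartAt (Euc n) p p)).range = ⊤ := by
    refine LinearMap.range_eq_top.2 (LinearMap.surjective fun h => hv ?_)
    rw [dirDeriv_eq_fderiv_comp_chartAt (hu.mdifferentiableAt one_ne_zero)]
    exact DFunLike.congr_fun h _
  refine ⟨_, (chartAt (Euc n) p).trans (hstrict.implicitToOpenPartialHomeomorph _ _ hrange),
    ?_, fun q hq => ?_⟩
  · exact ⟨mem_chart_source _ p, hstrict.mem_implicitToOpenPartialHomeomorph_source hrange⟩
  · rw [OpenPartialHomeomorph.trans_apply, hstrict.implicitToOpenPartialHomeomorph_fst,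
      Function.comp_apply, (chartAt (Euc n) p).left_inv hq.1]

theorem dirDeriv_neg_neg (u : F → ℝ) (p : F) (v : TangentSpace (𝓡 n) p) :
    dirDeriv (-u) p (-v) = dirDeriv u p v := by
  rw [dirDeriv, map_neg, mfderiv_neg, dirDeriv]
  exact neg_neg _

theorem hasDerivAt_comp_curve {γ : ℝ → F} {t : ℝ} {v : TangentSpace (𝓡 n) (γ t)}
    (hu : MDifferentiableAt (𝓡 n) 𝓘(ℝ, ℝ) u (γ t))
    (hγ : HasMFDerivAt 𝓘(ℝ, ℝ) (𝓡 n) γ t ((1 : ℝ →L[ℝ] ℝ).smulRight (v : Euc n))) :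
    HasDerivAt (u ∘ γ) (dirDeriv u (γ t) v) t := by
  let L : Euc n →L[ℝ] ℝ := mfderiv (𝓡 n) 𝓘(ℝ, ℝ) u (γ t)
  let w : Euc n := v
  have hcomp : HasFDerivAt (u ∘ γ) (L ∘L (1 : ℝ →L[ℝ] ℝ).smulRight w) t :=
    (hu.hasMFDerivAt.comp t hγ).hasFDerivAt
  have hLw : (L ∘L (1 : ℝ →L[ℝ] ℝ).smulRight w) 1 = L w := by simp
  exact hcomp.hasDerivAt.congr_deriv hLw

theorem frequently_mem_and_pos_of_pointsInto (hu : MDifferentiableAt (𝓡 n) 𝓘(ℝ, ℝ) u p)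
    (hup : u p = 0) (hv : 0 < dirDeriv u p v) {S : Set F} (hS : PointsInto p v S) :
    ∃ᶠ q in 𝓝 p, q ∈ S ∧ 0 < u q := by
  obtain ⟨γ, rfl, hγ, hγS⟩ := hS
  have hsign := eventually_nhdsWithin_sign_eq_of_deriv_pos (f := u ∘ γ) (x₀ := 0)
    ((hasDerivAt_comp_curve hu hγ).deriv.symm ▸ hv) hup
  refine (hγ.continuousAt.tendsto.mono_left nhdsWithin_le_nhds).frequently
    (Eventually.frequently ?_ (f := 𝓝[>] (0 : ℝ)))
  filter_upwards [hγS, hsign.filter_mono nhdsWithin_le_nhds, self_mem_nhdsWithin] with t ht hst h0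
  rw [sub_zero, sign_pos (mem_Ioi.1 h0), sign_eq_one_iff] at hst
  exact ⟨ht, hst⟩

theorem exists_nhds_sign_of_pointsInto [IsManifold (𝓡 n) 1 F]
    (hu : ContMDiffAt (𝓡 n) 𝓘(ℝ, ℝ) 1 u p) (hup : u p = 0) (hv : 0 < dirDeriv u p v)
    {P M : Set F} (hP : IsOpen P) (hM : IsOpen M) (hdisj : Disjoint P M)
    (hzero : ∀ q ∉ P ∪ M, u q = 0) (hvP : PointsInto p v P) (hvM : PointsInto p (-v) M) :
    ∃ U, IsOpen U ∧ p ∈ U ∧ (∀ q ∈ U ∩ P, 0 < u q) ∧ ∀ q ∈ U ∩ M, u q < 0 := by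
  have hmu : MDifferentiableAt (𝓡 n) 𝓘(ℝ, ℝ) u p := hu.mdifferentiableAt one_ne_zero
  obtain ⟨K, Φ, hpΦ, hΦ⟩ := exists_straightening hu hv.ne'
  obtain ⟨U, hUΦ, hU, hpU, hconn⟩ := exists_isPreconnected_inter_preimage_of_fst_eq hΦ hpΦ
  have hcover {S : Set ℝ} (hS : (0 : ℝ) ∉ S) : U ∩ u ⁻¹' S ⊆ P ∪ M := fun q hq =>
    by_contra fun h => hS (hzero q h ▸ hq.2)
  have hpos : U ∩ u ⁻¹' Ioi 0 ⊆ P := by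
    obtain ⟨q, ⟨hqP, hq⟩, hqU⟩ :=
      ((frequently_mem_and_pos_of_pointsInto hmu hup hv hvP).and_eventually
        (hU.eventually_mem hpU)).exists
    exact (hconn _ (convex_Ioi 0)).subset_left_of_subset_union hP hM hdisj
      (hcover self_notMem_Ioi) ⟨q, ⟨hqU, hq⟩, hqP⟩
  have hneg : U ∩ u ⁻¹' Iio 0 ⊆ M := by
    obtain ⟨q, ⟨hqM, hq⟩, hqU⟩ :=
      ((frequently_mem_and_pos_of_pointsInto (u := -u) hmu.neg (neg_eq_zero.2 hup)
        (by rwa [dirDeriv_neg_neg]) hvM).and_eventually (hU.eventually_mem hpU)).exists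
    exact (hconn _ (convex_Iio 0)).subset_right_of_subset_union hP hM hdisj
      (hcover self_notMem_Iio) ⟨q, ⟨hqU, neg_pos.1 hq⟩, hqM⟩
  have himage {S : Set F} (hS : IsOpen S) : IsOpen (u '' (U ∩ S)) :=
    isOpen_image_of_fst_eq hΦ (hU.inter hS) (inter_subset_left.trans hUΦ)
  refine ⟨U, hU, hpU, fun q hq => ?_, fun q hq => ?_⟩
  · have hnonneg : u '' (U ∩ P) ⊆ Ici 0 := forall_mem_image.2 fun x hx =>
      mem_Ici.2 <| not_lt.1 fun h => disjoint_left.1 hdisj hx.2 (hneg ⟨hx.1, h⟩)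
    rw [← mem_Ioi, ← interior_Ici]
    exact interior_maximal hnonneg (himage hP) (mem_image_of_mem u hq)
  · have hnonpos : u '' (U ∩ M) ⊆ Iic 0 := forall_mem_image.2 fun x hx =>
      mem_Iic.2 <| not_lt.1 fun h => disjoint_left.1 hdisj (hpos ⟨hx.1, h⟩) hx.2
    rw [← mem_Iio, ← interior_Iic]
    exact interior_maximal hnonpos (himage hM) (mem_image_of_mem u hq)

theorem exists_isOpen_superset_sign_of_pointsInto [IsManifold (𝓡 n) 1 F]
    (hu : ContMDiff (𝓡 n) 𝓘(ℝ, ℝ) 1 u) {N P M : Set F} (hP : IsOpen P) (hM : IsOpen M)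
    (hdisj : Disjoint P M) (hsep : P ∪ M = Nᶜ) (hzero : ∀ p ∈ N, u p = 0)
    (hsides : ∀ p ∈ N, ∃ v : TangentSpace (𝓡 n) p,
      PointsInto p v P ∧ PointsInto p (-v) M ∧ 0 < dirDeriv u p v) :
    ∃ U, IsOpen U ∧ N ⊆ U ∧ (∀ q ∈ U ∩ P, 0 < u q) ∧ ∀ q ∈ U ∩ M, u q < 0 := by
  have hlocal (p : N) : ∃ U, IsOpen U ∧ ↑p ∈ U ∧ (∀ q ∈ U ∩ P, 0 < u q) ∧ ∀ q ∈ U ∩ M, u q < 0 :=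
    let ⟨_, hvP, hvM, hv⟩ := hsides p p.2
    exists_nhds_sign_of_pointsInto (hu p) (hzero p p.2) hv hP hM hdisj
      (fun q hq => hzero q (notMem_compl_iff.1 fun hqN => hq (hsep ▸ hqN))) hvP hvM
  choose U hU hpU hUP hUM using hlocal
  refine ⟨⋃ p, U p, isOpen_iUnion hU, fun p hp => mem_iUnion.2 ⟨⟨p, hp⟩, hpU ⟨p, hp⟩⟩,
    fun q ⟨hq, hqP⟩ => ?_, fun q ⟨hq, hqM⟩ => ?_⟩ <;> obtain ⟨p, hp⟩ := mem_iUnion.1 hq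
  exacts [hUP p q ⟨hp, hqP⟩, hUM p q ⟨hp, hqM⟩]

end Sides

/-! ### Schrödinger operators and smooth gluing -/

section SmoothGluing

/-- The function `f (1 + δ η(s))` with `η = smoothMin`, which passes from `f (1 + δ s)` where
`s ≤ -1` to `f` where `s ≥ 1`. -/
def smoothGluing {X : Type*} (f δ s : X → ℝ) : X → ℝ :=
  f + f * (δ * (smoothMin ∘ s))

theorem smoothGluing_of_one_le {X : Type*} {s : X → ℝ} {p : X} (f δ : X → ℝ) (hsp : 1 ≤ s p) :
    smoothGluing f δ s p = f p := by
  simp only [smoothGluing, Pi.add_apply, Pi.mul_apply, Function.comp_apply,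
    smoothMin_of_one_le hsp, mul_zero, add_zero]

theorem smoothGluing_of_le_neg_one {X : Type*} {s : X → ℝ} {p : X} (f δ : X → ℝ)
    (hsp : s p ≤ -1) : smoothGluing f δ s p = (f + f * (δ * s)) p := by
  simp only [smoothGluing, Pi.add_apply, Pi.mul_apply, Function.comp_apply,
    smoothMin_of_le_neg_one hsp]

theorem smoothGluing_pos {X : Type*} {f δ s : X → ℝ} {p : X} (hf : 0 < f p) (hδ0 : 0 < δ p)
    (hδ1 : δ p < 1) (hfδs : 0 < (f + f * (δ * s)) p) : 0 < smoothGluing f δ s p := by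
  rcases le_total (s p) (-1) with hsp | hsp
  · rwa [smoothGluing_of_le_neg_one f δ hsp]
  · have hη : -1 ≤ smoothMin (s p) := (smoothMin_of_le_neg_one le_rfl).symm.trans_le
      (monotone_of_hasDerivAt_nonneg hasDerivAt_smoothMin smoothMinSlope_nonneg hsp)
    calc 0 < f p * (1 + δ p * smoothMin (s p)) := mul_pos hf (by nlinarith)
      _ = smoothGluing f δ s p := by
        simp only [smoothGluing, Pi.add_apply, Pi.mul_apply, Function.comp_apply]
        ring

theorem smoothGluing_principal_pos {x y d : ℝ} (t : ℝ) (hx : 0 < x) (hy : 0 < y) (hd0 : 0 ≤ d)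
    (hd1 : d < 1) :
    0 < (1 - smoothMinSlope t - smoothMinDefect t * d) * x + smoothMinSlope t * y := by
  have hdefect := smoothMinDefect_le_one_sub_slope t
  have hdefect_mul := mul_le_mul_of_nonneg_right hdefect hd0
  rcases ((smoothMinDefect_nonneg t).trans hdefect).eq_or_lt with hslope | hslope
  · have hzero : smoothMinDefect t = 0 :=
      le_antisymm (hdefect.trans_eq hslope.symm) (smoothMinDefect_nonneg t)
    rwa [hzero, ← hslope, zero_mul, sub_zero, zero_mul, zero_add, ← sub_eq_zero.1 hslope.symm,
      one_mul]
  · have hcoeff : 0 < 1 - smoothMinSlope t - smoothMinDefect t * d := by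
      linarith [mul_lt_mul_of_pos_left hd1 hslope]
    exact add_pos_of_pos_of_nonneg (mul_pos hcoeff hx) (mul_nonneg (smoothMinSlope_nonneg t) hy.le)

variable {E H X : Type*} [NormedAddCommGroup E] [NormedSpace ℝ E] [TopologicalSpace H]
  {I : ModelWithCorners ℝ E H} [TopologicalSpace X] [ChartedSpace H X] {f δ s : X → ℝ} {k : ℕ∞}
  {p : X}

theorem contMDiffAt_smoothMin_comp (hs : ContMDiffAt I 𝓘(ℝ, ℝ) k s p) :
    ContMDiffAt I 𝓘(ℝ, ℝ) k (smoothMin ∘ s) p :=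
  (contDiff_smoothMin.of_le (mod_cast le_top)).contMDiff.contMDiffAt.comp p hs

theorem contMDiffAt_smoothGluing (hf : ContMDiffAt I 𝓘(ℝ, ℝ) k f p)
    (hδ : ContMDiffAt I 𝓘(ℝ, ℝ) k δ p) (hs : ContMDiffAt I 𝓘(ℝ, ℝ) k s p) :
    ContMDiffAt I 𝓘(ℝ, ℝ) k (smoothGluing f δ s) p :=
  hf.add (hf.mul (hδ.mul (contMDiffAt_smoothMin_comp hs)))

end SmoothGluing

section Schrodinger

variable {n : ℕ} {F : Type*} [TopologicalSpace F] [ChartedSpace (EuclideanSpace ℝ (Fin n)) F]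
  [IsManifold (𝓡 n) ∞ F] (g : SmoothMetric n F) {V f a b δ s : F → ℝ} {p : F}

/-- The Schrödinger operator `-Δ + V` with potential `V`. The conformal Laplacian is the case of
the potential `(n - 2) / (4 (n - 1)) · scal`. -/
def schrodinger (V f : F → ℝ) (p : F) : ℝ :=
  -laplacian g f p + V p * f p

/-- The Laplacian `Δ_f a = Δ a + (2 / f) ⟨∇ f, ∇ a⟩` of the measure with density `f²`. It describes
the action of `L = -Δ + V` on multiples of `f`: `L (f a) = a L f - f Δ_f a`. -/
def weightedLaplacian (f a : F → ℝ) (p : F) : ℝ :=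
  laplacian g a p + 2 / f p * gradInner g f a p

theorem schrodinger_congr (V : F → ℝ) (h : a =ᶠ[𝓝 p] b) :
    schrodinger g V a p = schrodinger g V b p := by
  rw [schrodinger, schrodinger, laplacian_congr g h, h.self_of_nhds]

theorem schrodinger_add_mul (V : F → ℝ) (hf : ContMDiffAt (𝓡 n) 𝓘(ℝ, ℝ) 2 f p)
    (ha : ContMDiffAt (𝓡 n) 𝓘(ℝ, ℝ) 2 a p) (hfp : f p ≠ 0) :
    schrodinger g V (f + f * a) p =
      (1 + a p) * schrodinger g V f p - f p * weightedLaplacian g f a p := by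
  rw [schrodinger, schrodinger, weightedLaplacian, laplacian_add g hf (hf.mul ha),
    laplacian_mul g hf ha, Pi.add_apply, Pi.mul_apply]
  field_simp
  ring

theorem weightedLaplacian_add (f : F → ℝ) (ha : ContMDiffAt (𝓡 n) 𝓘(ℝ, ℝ) 2 a p)
    (hb : ContMDiffAt (𝓡 n) 𝓘(ℝ, ℝ) 2 b p) :
    weightedLaplacian g f (a + b) p = weightedLaplacian g f a p + weightedLaplacian g f b p := by
  simp only [weightedLaplacian, laplacian_add g ha hb, gradInner_add_right g f
    (ha.mdifferentiableAt two_ne_zero) (hb.mdifferentiableAt two_ne_zero)]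
  ring

theorem weightedLaplacian_const_smul (f : F → ℝ) (c : ℝ) (ha : ContMDiffAt (𝓡 n) 𝓘(ℝ, ℝ) 2 a p) :
    weightedLaplacian g f (c • a) p = c * weightedLaplacian g f a p := by
  rw [weightedLaplacian, laplacian_const_smul g c ha,
    gradInner_const_smul_right g f c (ha.mdifferentiableAt two_ne_zero), weightedLaplacian]
  ring

theorem weightedLaplacian_congr (f : F → ℝ) (h : a =ᶠ[𝓝 p] b) :
    weightedLaplacian g f a p = weightedLaplacian g f b p := by
  rw [weightedLaplacian, weightedLaplacian, laplacian_congr g h, gradInner_congr_right g f h]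

theorem continuous_weightedLaplacian (hf : ContMDiff (𝓡 n) 𝓘(ℝ, ℝ) 1 f) (hf0 : ∀ p, f p ≠ 0)
    (ha : ContMDiff (𝓡 n) 𝓘(ℝ, ℝ) 2 a) : Continuous (weightedLaplacian g f a) :=
  (continuous_laplacian g ha).add
    ((continuous_const.div hf.continuous hf0).mul (continuous_gradInner g hf (ha.of_le one_le_two)))

theorem weightedLaplacian_mul (f : F → ℝ) (ha : ContMDiffAt (𝓡 n) 𝓘(ℝ, ℝ) 2 a p)
    (hb : ContMDiffAt (𝓡 n) 𝓘(ℝ, ℝ) 2 b p) :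
    weightedLaplacian g f (a * b) p =
      a p * weightedLaplacian g f b p + b p * weightedLaplacian g f a p
        + 2 * gradInner g a b p := by
  rw [weightedLaplacian, laplacian_mul g ha hb, gradInner_mul_right g f
    (ha.mdifferentiableAt two_ne_zero) (hb.mdifferentiableAt two_ne_zero), weightedLaplacian,
    weightedLaplacian]
  ring

theorem weightedLaplacian_comp (f : F → ℝ) {ψ ψ' : ℝ → ℝ} {ψ'' : ℝ}
    (hψ : ∀ t, HasDerivAt ψ (ψ' t) t) (hψ' : HasDerivAt ψ' ψ'' (a p))
    (ha : ContMDiffAt (𝓡 n) 𝓘(ℝ, ℝ) 2 a p) :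
    weightedLaplacian g f (ψ ∘ a) p =
      ψ' (a p) * weightedLaplacian g f a p + ψ'' * gradInner g a a p := by
  rw [weightedLaplacian, laplacian_comp g hψ hψ' ha,
    gradInner_comp_right g f (hψ _) (ha.mdifferentiableAt two_ne_zero), weightedLaplacian]
  ring

theorem weightedLaplacian_mul_smoothMin (f : F → ℝ) (ha : ContMDiffAt (𝓡 n) 𝓘(ℝ, ℝ) 2 a p)
    (hs : ContMDiffAt (𝓡 n) 𝓘(ℝ, ℝ) 2 s p) :
    weightedLaplacian g f (a * (smoothMin ∘ s)) p =
      smoothMinSlope (s p) * weightedLaplacian g f (a * s) p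
        - smoothMinDefect (s p) * weightedLaplacian g f a p
        - a p * smoothMinDensity (s p) * gradInner g s s p := by
  rw [weightedLaplacian_mul g f ha (contMDiffAt_smoothMin_comp (k := 2) hs),
    weightedLaplacian_comp g f hasDerivAt_smoothMin (hasDerivAt_smoothMinSlope _) hs,
    gradInner_comp_right g a (hasDerivAt_smoothMin _) (hs.mdifferentiableAt two_ne_zero),
    weightedLaplacian_mul g f ha hs, Function.comp_apply, smoothMin]
  ring

theorem schrodinger_smoothGluing (V : F → ℝ) (hf : ContMDiffAt (𝓡 n) 𝓘(ℝ, ℝ) 2 f p)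
    (hδ : ContMDiffAt (𝓡 n) 𝓘(ℝ, ℝ) 2 δ p) (hs : ContMDiffAt (𝓡 n) 𝓘(ℝ, ℝ) 2 s p)
    (hfp : f p ≠ 0) :
    schrodinger g V (smoothGluing f δ s) p =
      (1 - smoothMinSlope (s p) - smoothMinDefect (s p) * δ p) * schrodinger g V f p
        + smoothMinSlope (s p) * schrodinger g V (f + f * (δ * s)) p
        + f p * (smoothMinDefect (s p) * weightedLaplacian g f δ p
          + smoothMinDensity (s p) * (δ p * gradInner g s s p)) := by
  rw [smoothGluing, schrodinger_add_mul g V hf (hδ.mul (contMDiffAt_smoothMin_comp (k := 2) hs))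
    hfp, schrodinger_add_mul g V hf (hδ.mul hs) hfp, weightedLaplacian_mul_smoothMin g f hδ hs]
  simp only [Pi.mul_apply, Function.comp_apply, smoothMin]
  ring

theorem gradInner_mul_self_sub_le (hδ : MDifferentiableAt (𝓡 n) 𝓘(ℝ, ℝ) δ p)
    (hs : MDifferentiableAt (𝓡 n) 𝓘(ℝ, ℝ) s p) (hsp : |s p| ≤ 1) :
    gradInner g (δ * s) (δ * s) p - |2 * gradInner g (δ * s) δ p|
      ≤ δ p ^ 2 * gradInner g s s p := by
  have hexpand : δ p ^ 2 * gradInner g s s p = gradInner g (δ * s) (δ * s) p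
      - s p * (2 * gradInner g (δ * s) δ p) + s p ^ 2 * gradInner g δ δ p := by
    rw [gradInner_mul_right g (δ * s) hδ hs, gradInner_comm g (δ * s) s,
      gradInner_comm g (δ * s) δ, gradInner_mul_right g δ hδ hs, gradInner_mul_right g s hδ hs,
      gradInner_comm g s δ]
    ring
  have hcross : s p * (2 * gradInner g (δ * s) δ p) ≤ |2 * gradInner g (δ * s) δ p| :=
    (le_abs_self _).trans ((abs_mul _ _).trans_le (mul_le_of_le_one_left (abs_nonneg _) hsp))
  have hsquare := mul_nonneg (sq_nonneg (s p)) (gradInner_self_nonneg g δ p)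
  linarith

theorem smoothGluing_error_nonneg (hδ : MDifferentiableAt (𝓡 n) 𝓘(ℝ, ℝ) δ p)
    (hs : MDifferentiableAt (𝓡 n) 𝓘(ℝ, ℝ) s p) (hδ0 : 0 ≤ δ p) (hδ1 : δ p ≤ 1) {x : ℝ}
    (hx : |x| + |2 * gradInner g (δ * s) δ p| ≤ gradInner g (δ * s) (δ * s) p) :
    0 ≤ smoothMinDefect (s p) * x + smoothMinDensity (s p) * (δ p * gradInner g s s p) := by
  rcases le_or_gt 1 |s p| with hsp | hsp
  · rw [smoothMinDefect_eq_zero hsp, smoothMinDensity_eq_zero hsp, zero_mul, zero_mul, add_zero]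
  · have hxs : |x| ≤ δ p * gradInner g s s p := by
      calc |x| ≤ gradInner g (δ * s) (δ * s) p - |2 * gradInner g (δ * s) δ p| :=
            le_sub_right_of_add_le hx
        _ ≤ δ p ^ 2 * gradInner g s s p := gradInner_mul_self_sub_le g hδ hs hsp.le
        _ ≤ δ p * gradInner g s s p := mul_le_mul_of_nonneg_right
            (pow_le_of_le_one hδ0 hδ1 two_ne_zero) (gradInner_self_nonneg g s p)
    have hterm : smoothMinDefect (s p) * -x ≤ smoothMinDensity (s p) * (δ p * gradInner g s s p) :=
      mul_le_mul_of_nonneg (smoothMinDefect_le_density _) ((neg_le_abs x).trans hxs)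
        (smoothMinDefect_nonneg _) ((abs_nonneg x).trans hxs)
    linarith

theorem schrodinger_smoothGluing_pos (V : F → ℝ) (hf : ContMDiffAt (𝓡 n) 𝓘(ℝ, ℝ) 2 f p)
    (hδ : ContMDiffAt (𝓡 n) 𝓘(ℝ, ℝ) 2 δ p) (hs : ContMDiffAt (𝓡 n) 𝓘(ℝ, ℝ) 2 s p)
    (hfp : 0 < f p) (hδ0 : 0 ≤ δ p) (hδ1 : δ p < 1) (hL : 0 < schrodinger g V f p)
    (hL' : 0 < schrodinger g V (f + f * (δ * s)) p)
    (hsmall : |weightedLaplacian g f δ p| + |2 * gradInner g (δ * s) δ p|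
      ≤ gradInner g (δ * s) (δ * s) p) :
    0 < schrodinger g V (smoothGluing f δ s) p := by
  rw [schrodinger_smoothGluing g V hf hδ hs hfp.ne']
  exact add_pos_of_pos_of_nonneg (smoothGluing_principal_pos _ hL hL' hδ0 hδ1)
    (mul_nonneg hfp.le (smoothGluing_error_nonneg g (hδ.mdifferentiableAt two_ne_zero)
      (hs.mdifferentiableAt two_ne_zero) hδ0 hδ1.le hsmall))

end Schrodinger

section GluingWidth

theorem exists_lower_bound_ite {X : Type*} [TopologicalSpace X] {C : Set X} (hC : IsClosed C)
    {h : X → ℝ} (hh : Continuous h) (hpos : ∀ p ∈ C, 0 < h p) [DecidablePred (· ∈ C)] (p : X) :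
    ∃ c > 0, ∀ᶠ x in 𝓝 p, c ≤ if x ∈ C then h x else 1 := by
  by_cases hp : p ∈ C
  · refine ⟨min (h p / 2) 1, lt_min (half_pos (hpos p hp)) one_pos, ?_⟩
    filter_upwards [hh.continuousAt.eventually (lt_mem_nhds (half_lt_self (hpos p hp)))] with x hx
    split_ifs
    · exact (min_le_left _ _).trans hx.le
    · exact min_le_right _ _
  · refine ⟨1, one_pos, ?_⟩
    filter_upwards [hC.isOpen_compl.mem_nhds hp] with x hx
    rw [if_neg hx]

variable {n : ℕ} {F : Type*} [TopologicalSpace F] [ChartedSpace (EuclideanSpace ℝ (Fin n)) F]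

theorem isLocalSublinear_abs :
    IsLocalSublinear (𝓡 n) fun (a : F → ℝ) p => |a p| :=
  .abs_linear (L := id) (fun _ _ _ => rfl) (fun _ _ _ _ => rfl) Filter.EventuallyEq.eq_of_nhds
    ContMDiff.continuous

variable [IsManifold (𝓡 n) ∞ F] (g : SmoothMetric n F) {f r : F → ℝ}

theorem isLocalSublinear_abs_weightedLaplacian (hf : ContMDiff (𝓡 n) 𝓘(ℝ, ℝ) 1 f)
    (hf0 : ∀ p, f p ≠ 0) :
    IsLocalSublinear (𝓡 n) fun a p => |weightedLaplacian g f a p| :=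
  .abs_linear
    (fun ha hb p => weightedLaplacian_add g f ((ha.of_le ENat.LEInfty.out) p)
      ((hb.of_le ENat.LEInfty.out) p))
    (fun c _ ha p => weightedLaplacian_const_smul g f c ((ha.of_le ENat.LEInfty.out) p))
    (weightedLaplacian_congr g f)
    fun ha => continuous_weightedLaplacian g hf hf0 (ha.of_le ENat.LEInfty.out)

theorem isLocalSublinear_abs_gradInner (hr : ContMDiff (𝓡 n) 𝓘(ℝ, ℝ) 1 r) :
    IsLocalSublinear (𝓡 n) fun a p => |2 * gradInner g r a p| :=
  .abs_linear
    (fun ha hb p => by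
      rw [gradInner_add_right g r ((ha p).mdifferentiableAt (by simp))
        ((hb p).mdifferentiableAt (by simp)), mul_add])
    (fun c a ha p => by
      rw [gradInner_const_smul_right g r c ((ha p).mdifferentiableAt (by simp)), mul_left_comm])
    (fun h => by rw [gradInner_congr_right g r h])
    fun ha => continuous_const.mul (continuous_gradInner g hr (ha.of_le ENat.LEInfty.out))

theorem exists_gluing_width [T2Space F] [SigmaCompactSpace F]
    (hf : ContMDiff (𝓡 n) 𝓘(ℝ, ℝ) 1 f) (hf0 : ∀ p, f p ≠ 0) (hr : ContMDiff (𝓡 n) 𝓘(ℝ, ℝ) 1 r)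
    {A C : Set F} (hA : IsClosed A) (hC : IsClosed C) (hAr : ∀ p ∈ A, r p ≠ 0)
    (hCr : ∀ p ∈ C, 0 < gradInner g r r p) :
    ∃ δ : F → ℝ, ContMDiff (𝓡 n) 𝓘(ℝ, ℝ) ∞ δ ∧ (∀ p, 0 < δ p) ∧ (∀ p, δ p < 1) ∧
      (∀ p ∈ A, δ p < |r p|) ∧
      ∀ p ∈ C, |weightedLaplacian g f δ p| + |2 * gradInner g r δ p| ≤ gradInner g r r p := by
  classical
  have hε (p : F) : ∃ c > 0, ∀ᶠ x in 𝓝 p, c ≤ min (1 / 2)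
      (min (if x ∈ C then gradInner g r r x else 1) (if x ∈ A then |r x| / 2 else 1)) := by
    obtain ⟨c, hc, h⟩ := exists_lower_bound_ite hC (continuous_gradInner g hr hr) hCr p
    obtain ⟨c', hc', h'⟩ := exists_lower_bound_ite hA (hr.continuous.abs.div_const 2)
      (fun p hp => half_pos (abs_pos.2 (hAr p hp))) p
    refine ⟨min (1 / 2) (min c c'), by positivity, ?_⟩
    filter_upwards [h, h'] with x hx hx'
    exact min_le_min_left _ (min_le_min hx hx')
  obtain ⟨δ, hδ, hδ0, hδε⟩ := (isLocalSublinear_abs.add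
    ((isLocalSublinear_abs_weightedLaplacian g hf hf0).add
      (isLocalSublinear_abs_gradInner g hr))).exists_pos_contMDiff_le hε
  simp only [Pi.add_apply, le_min_iff] at hδε
  have hle (p) {x : ℝ} (h : |δ p| + (|weightedLaplacian g f δ p| + |2 * gradInner g r δ p|) ≤ x) :
      δ p ≤ x :=
    (le_abs_self _).trans ((le_add_of_nonneg_right (by positivity)).trans h)
  refine ⟨δ, hδ, hδ0, fun p => (hle p (hδε p).1).trans_lt one_half_lt_one, fun p hp => ?_,
    fun p hp => ?_⟩
  · have h := (hδε p).2.2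
    rw [if_pos hp] at h
    exact (hle p h).trans_lt (half_lt_self (abs_pos.2 (hAr p hp)))
  · have h := (hδε p).2.1
    rw [if_pos hp] at h
    exact (le_add_of_nonneg_left (abs_nonneg _)).trans h

end GluingWidth

theorem exists_eventuallyEq_of_sides {X Y : Type*} [TopologicalSpace X] {f f' h₀ : X → Y}
    {P M V : Set X} (hP : IsOpen P) (hM : IsOpen M) (hdisj : Disjoint P M) (hV : IsOpen V)
    (hcover : Vᶜ ⊆ P ∪ M) (hPf : ∀ p ∈ P \ V, ∀ᶠ q in 𝓝 p, q ∈ V → h₀ q = f q)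
    (hMf' : ∀ p ∈ M \ V, ∀ᶠ q in 𝓝 p, q ∈ V → h₀ q = f' q) :
    ∃ h : X → Y, (∀ p, (p ∈ V ∧ h =ᶠ[𝓝 p] h₀) ∨ h =ᶠ[𝓝 p] f ∨ h =ᶠ[𝓝 p] f') ∧
      (∀ p ∈ P \ V, h p = f p) ∧ ∀ p ∈ M \ V, h p = f' p := by
  classical
  let h : X → Y := fun p => if p ∈ V then h₀ p else if p ∈ P then f p else f' p
  have hhV {q} (hq : q ∈ V) : h q = h₀ q := if_pos hq
  have hhP {q} (hqP : q ∈ P) (hq : q ∉ V) : h q = f q := (if_neg hq).trans (if_pos hqP)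
  have hhM {q} (hqM : q ∈ M) (hq : q ∉ V) : h q = f' q :=
    (if_neg hq).trans (if_neg fun hqP => disjoint_left.1 hdisj hqP hqM)
  refine ⟨h, fun p => ?_, fun p hp => hhP hp.1 hp.2, fun p hp => hhM hp.1 hp.2⟩
  by_cases hp : p ∈ V
  · exact .inl ⟨hp, (hV.eventually_mem hp).mono fun q => hhV⟩
  rcases hcover hp with hpP | hpM
  · refine .inr (.inl ?_)
    filter_upwards [hP.eventually_mem hpP, hPf p ⟨hpP, hp⟩] with q hqP hqf
    by_cases hq : q ∈ V
    · exact (hhV hq).trans (hqf hq)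
    · exact hhP hqP hq
  · refine .inr (.inr ?_)
    filter_upwards [hM.eventually_mem hpM, hMf' p ⟨hpM, hp⟩] with q hqM hqf'
    by_cases hq : q ∈ V
    · exact (hhV hq).trans (hqf' hq)
    · exact hhM hqM hq

section Gluing

variable {n : ℕ} {F : Type*} [TopologicalSpace F] [ChartedSpace (EuclideanSpace ℝ (Fin n)) F]
  [IsManifold (𝓡 n) ∞ F] [T2Space F] [SigmaCompactSpace F] (g : SmoothMetric n F) {f r : F → ℝ}

theorem exists_smoothGluing (V : F → ℝ) (hf : ContMDiff (𝓡 n) 𝓘(ℝ, ℝ) ∞ f)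
    (hr : ContMDiff (𝓡 n) 𝓘(ℝ, ℝ) ∞ r) (hf0 : ∀ p, 0 < f p) (hfr0 : ∀ p, 0 < (f + f * r) p)
    (hL : ∀ p, 0 < schrodinger g V f p) (hL' : ∀ p, 0 < schrodinger g V (f + f * r) p) {U : Set F}
    (hU : IsOpen U) (hgrad : ∀ p ∈ closure U, 0 < gradInner g r r p)
    (hfrontier : ∀ p ∈ frontier U, r p ≠ 0) :
    ∃ h₀ : F → ℝ, ContMDiff (𝓡 n) 𝓘(ℝ, ℝ) ∞ h₀ ∧ (∀ p, 0 < h₀ p) ∧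
      (∀ p ∈ U, 0 < schrodinger g V h₀ p) ∧
      ∀ p ∉ U, ∀ᶠ q in 𝓝 p, q ∈ U →
        (0 < r q → h₀ q = f q) ∧ (r q < 0 → h₀ q = (f + f * r) q) := by
  obtain ⟨δ, hδ, hδ0, hδ1, hδr, hsmall⟩ := exists_gluing_width g (hf.of_le ENat.LEInfty.out)
    (fun p => (hf0 p).ne') (hr.of_le ENat.LEInfty.out) isClosed_frontier isClosed_closure
    hfrontier hgrad
  set s : F → ℝ := fun p => r p / δ p with hs_def
  have hs : ContMDiff (𝓡 n) 𝓘(ℝ, ℝ) ∞ s := hr.div₀ hδ fun p => (hδ0 p).ne'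
  have hδs : δ * s = r := funext fun p => mul_div_cancel₀ _ (hδ0 p).ne'
  refine ⟨smoothGluing f δ s, fun p => contMDiffAt_smoothGluing (hf p) (hδ p) (hs p), fun p =>
    smoothGluing_pos (hf0 p) (hδ0 p) (hδ1 p) (by rw [hδs]; exact hfr0 p), fun p hp => ?_,
    fun p hp => ?_⟩
  · exact schrodinger_smoothGluing_pos g V (hf.of_le ENat.LEInfty.out p)
      (hδ.of_le ENat.LEInfty.out p) (hs.of_le ENat.LEInfty.out p) (hf0 p) (hδ0 p).le (hδ1 p) (hL p)
      (by rw [hδs]; exact hL' p) (by rw [hδs]; exact hsmall p (subset_closure hp))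
  · have hlarge : ∀ᶠ q in 𝓝 p, q ∈ U → δ q < |r q| := by
      by_cases hpU : p ∈ closure U
      · have hpf : p ∈ frontier U := ⟨hpU, by rwa [hU.interior_eq]⟩
        exact (hδ.continuous.continuousAt.eventually_lt hr.continuous.abs.continuousAt
          (hδr p hpf)).mono fun q hq _ => hq
      · exact (isClosed_closure.isOpen_compl.eventually_mem hpU).mono fun q hq hqU =>
          absurd (subset_closure hqU) hq
    filter_upwards [hlarge] with q hq hqU
    refine ⟨fun hrq => smoothGluing_of_one_le f δ ?_, fun hrq =>
      (smoothGluing_of_le_neg_one f δ ?_).trans (by rw [hδs])⟩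
    · exact (one_le_div (hδ0 q)).2 (abs_of_pos hrq ▸ (hq hqU).le)
    · rw [hs_def, div_le_iff₀ (hδ0 q), neg_one_mul]
      exact le_neg_of_le_neg (abs_of_neg hrq ▸ (hq hqU).le)

theorem exists_glued (V : F → ℝ) (hf : ContMDiff (𝓡 n) 𝓘(ℝ, ℝ) ∞ f)
    (hr : ContMDiff (𝓡 n) 𝓘(ℝ, ℝ) ∞ r) (hf0 : ∀ p, 0 < f p) (hfr0 : ∀ p, 0 < (f + f * r) p)
    (hL : ∀ p, 0 < schrodinger g V f p) (hL' : ∀ p, 0 < schrodinger g V (f + f * r) p)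
    {N P M W : Set F} (hP : IsOpen P) (hM : IsOpen M) (hdisj : Disjoint P M) (hsep : P ∪ M = Nᶜ)
    (hW : IsOpen W) (hNW : N ⊆ W) (hgrad : ∀ p ∈ W, 0 < gradInner g r r p)
    (hWP : ∀ p ∈ W ∩ P, 0 < r p) (hWM : ∀ p ∈ W ∩ M, r p < 0) :
    ∃ h : F → ℝ, ContMDiff (𝓡 n) 𝓘(ℝ, ℝ) ∞ h ∧ (∀ p, 0 < h p) ∧ (∀ p, 0 < schrodinger g V h p) ∧
      (∀ p ∈ P \ W, h p = f p) ∧ ∀ p ∈ M \ W, h p = (f + f * r) p := by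
  have : LocallyCompactSpace F := ChartedSpace.locallyCompactSpace (EuclideanSpace ℝ (Fin n)) F
  have hN : IsClosed N := isOpen_compl_iff.1 (hsep ▸ hP.union hM)
  obtain ⟨U, hU, hNU, hUW⟩ := normal_exists_closure_subset hN hW hNW
  have hcover : Uᶜ ⊆ P ∪ M := hsep ▸ compl_subset_compl.2 hNU
  have hfrontier : ∀ p ∈ frontier U, r p ≠ 0 := fun p hp => by
    have hpW : p ∈ W := hUW (frontier_subset_closure hp)
    rcases hcover (hU.frontier_eq ▸ hp).2 with hpP | hpM
    exacts [(hWP p ⟨hpW, hpP⟩).ne', (hWM p ⟨hpW, hpM⟩).ne]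
  obtain ⟨h₀, hh₀, hh₀0, hh₀L, hh₀r⟩ := exists_smoothGluing g V hf hr hf0 hfr0 hL hL' hU
    (fun p hp => hgrad p (hUW hp)) hfrontier
  obtain ⟨h, hgerm, hhP, hhM⟩ := exists_eventuallyEq_of_sides (f := f) (f' := f + f * r) (h₀ := h₀)
    hP hM hdisj hU hcover
    (fun p hp => by
      filter_upwards [hh₀r p hp.2, hP.eventually_mem hp.1] with q hq hqP hqU
      exact (hq hqU).1 (hWP q ⟨hUW (subset_closure hqU), hqP⟩))
    (fun p hp => by
      filter_upwards [hh₀r p hp.2, hM.eventually_mem hp.1] with q hq hqM hqU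
      exact (hq hqU).2 (hWM q ⟨hUW (subset_closure hqU), hqM⟩))
  have hlocal (p) : ContMDiffAt (𝓡 n) 𝓘(ℝ, ℝ) ∞ h p ∧ 0 < h p ∧ 0 < schrodinger g V h p := by
    rcases hgerm p with ⟨hp, heq⟩ | heq | heq <;>
      rw [heq.contMDiffAt_iff, heq.eq_of_nhds, schrodinger_congr g V heq]
    exacts [⟨hh₀ p, hh₀0 p, hh₀L p hp⟩, ⟨hf p, hf0 p, hL p⟩, ⟨hf.add (hf.mul hr) p, hfr0 p, hL' p⟩]
  exact ⟨h, fun p => (hlocal p).1, fun p => (hlocal p).2.1, fun p => (hlocal p).2.2,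
    fun p hp => hhP p ⟨hp.1, fun hpU => hp.2 (hUW (subset_closure hpU))⟩,
    fun p hp => hhM p ⟨hp.1, fun hpU => hp.2 (hUW (subset_closure hpU))⟩⟩

end Gluing

section Quotient

variable {n : ℕ} {F : Type*} [TopologicalSpace F] [ChartedSpace (EuclideanSpace ℝ (Fin n)) F]

theorem exists_contMDiff_eq_add_mul {f f' : F → ℝ} (hf : ContMDiff (𝓡 n) 𝓘(ℝ, ℝ) ∞ f)
    (hf' : ContMDiff (𝓡 n) 𝓘(ℝ, ℝ) ∞ f') (hf0 : ∀ p, f p ≠ 0) :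
    ∃ r : F → ℝ, ContMDiff (𝓡 n) 𝓘(ℝ, ℝ) ∞ r ∧ f' = f + f * r :=
  ⟨fun p => (f' p - f p) / f p, (hf'.sub hf).div₀ hf hf0, funext fun p => by
    rw [Pi.add_apply, Pi.mul_apply, mul_div_cancel₀ _ (hf0 p), add_sub_cancel]⟩

theorem dirDeriv_add_mul_of_eq_zero {f r : F → ℝ} {p : F}
    (hf : MDifferentiableAt (𝓡 n) 𝓘(ℝ, ℝ) f p) (hr : MDifferentiableAt (𝓡 n) 𝓘(ℝ, ℝ) r p)
    (hrp : r p = 0) (v : TangentSpace (𝓡 n) p) :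
    dirDeriv (f + f * r) p v = dirDeriv f p v + f p * dirDeriv r p v := by
  rw [dirDeriv_add hf (hf.mul hr), dirDeriv_mul hf hr, hrp, zero_mul, add_zero]

variable [IsManifold (𝓡 n) ∞ F] (g : SmoothMetric n F)

theorem exists_isOpen_superset_gradInner_pos_of_pointsInto {f r : F → ℝ}
    (hf : ContMDiff (𝓡 n) 𝓘(ℝ, ℝ) 1 f) (hr : ContMDiff (𝓡 n) 𝓘(ℝ, ℝ) 1 r) (hf0 : ∀ p, 0 < f p)
    {N P M : Set F} (hP : IsOpen P) (hM : IsOpen M) (hdisj : Disjoint P M) (hsep : P ∪ M = Nᶜ)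
    (hzero : ∀ p ∈ N, r p = 0)
    (hsides : ∀ p ∈ N, ∃ v : TangentSpace (𝓡 n) p,
      PointsInto p v P ∧ PointsInto p (-v) M ∧ dirDeriv f p v < dirDeriv (f + f * r) p v) :
    ∃ W, IsOpen W ∧ N ⊆ W ∧ (∀ p ∈ W, 0 < gradInner g r r p) ∧ (∀ p ∈ W ∩ P, 0 < r p) ∧
      ∀ p ∈ W ∩ M, r p < 0 := by
  have hr' (p) : MDifferentiableAt (𝓡 n) 𝓘(ℝ, ℝ) r p := hr.mdifferentiable one_ne_zero p
  have hrsides : ∀ p ∈ N, ∃ v : TangentSpace (𝓡 n) p,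
      PointsInto p v P ∧ PointsInto p (-v) M ∧ 0 < dirDeriv r p v := fun p hp => by
    obtain ⟨v, hvP, hvM, hv⟩ := hsides p hp
    rw [dirDeriv_add_mul_of_eq_zero (hf.mdifferentiable one_ne_zero p) (hr' p) (hzero p hp),
      lt_add_iff_pos_right] at hv
    exact ⟨v, hvP, hvM, pos_of_mul_pos_right hv (hf0 p).le⟩
  have hgrad : N ⊆ {p | 0 < gradInner g r r p} := fun p hp =>
    let ⟨_, _, _, hv⟩ := hrsides p hp
    gradInner_self_pos g (hr' p) hv.ne'
  obtain ⟨U, hU, hNU, hUP, hUM⟩ :=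
    exists_isOpen_superset_sign_of_pointsInto hr hP hM hdisj hsep hzero hrsides
  exact ⟨U ∩ {p | 0 < gradInner g r r p},
    hU.inter (isOpen_lt continuous_const (continuous_gradInner g hr hr)), subset_inter hNU hgrad,
    fun p hp => hp.2, fun p hp => hUP p ⟨hp.1.1, hp.2⟩, fun p hp => hUM p ⟨hp.1.1, hp.2⟩⟩

end Quotient

end ConformalSmoothing

end

open ConformalSmoothing in
theorem mainTheorem8_general {n : ℕ}
    {F : Type*} [TopologicalSpace F] [T2Space F] [SecondCountableTopology F]
    [ChartedSpace (EuclideanSpace ℝ (Fin n)) F] [IsManifold (𝓡 n) ∞ F]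
    (g : SmoothMetric n F) (V : F → ℝ) {N P M : Set F} (hP : IsOpen P) (hM : IsOpen M)
    (hdisj : Disjoint P M) (hsep : P ∪ M = Nᶜ) {f₁ f₂ : F → ℝ}
    (hf₁ : ContMDiff (𝓡 n) 𝓘(ℝ, ℝ) ∞ f₁) (hf₂ : ContMDiff (𝓡 n) 𝓘(ℝ, ℝ) ∞ f₂)
    (hpos₁ : ∀ p, 0 < f₁ p) (hpos₂ : ∀ p, 0 < f₂ p)
    (hL₁ : ∀ p, 0 < schrodinger g V f₁ p) (hL₂ : ∀ p, 0 < schrodinger g V f₂ p)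
    (heq : ∀ p ∈ N, f₁ p = f₂ p)
    (hnormal : ∀ p ∈ N, ∃ v : TangentSpace (𝓡 n) p,
      PointsInto p v P ∧ PointsInto p (-v) M ∧ dirDeriv f₂ p v < dirDeriv f₁ p v) :
    (∀ p ∈ N, (∀ᶠ q in 𝓝[P] p, f₂ q < f₁ q) ∧ ∀ᶠ q in 𝓝[M] p, f₁ q < f₂ q) ∧
    ∀ E ∈ 𝓝ˢ N, ∃ fE : F → ℝ,
      ContMDiff (𝓡 n) 𝓘(ℝ, ℝ) ∞ fE ∧ (∀ p, 0 < fE p) ∧ (∀ p, 0 < schrodinger g V fE p) ∧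
      (∀ p ∈ P \ E, fE p = f₂ p) ∧ ∀ p ∈ M \ E, fE p = f₁ p := by
  have : LocallyCompactSpace F := ChartedSpace.locallyCompactSpace (EuclideanSpace ℝ (Fin n)) F
  obtain ⟨r, hr, rfl⟩ := exists_contMDiff_eq_add_mul hf₂ hf₁ fun p => (hpos₂ p).ne'
  have hzero : ∀ p ∈ N, r p = 0 := fun p hp =>
    (mul_eq_zero.1 (add_eq_left.1 (heq p hp))).resolve_left (hpos₂ p).ne'
  obtain ⟨W, hW, hNW, hgrad, hWP, hWM⟩ := exists_isOpen_superset_gradInner_pos_of_pointsInto g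
    (hf₂.of_le ENat.LEInfty.out) (hr.of_le ENat.LEInfty.out) hpos₂ hP hM hdisj hsep hzero hnormal
  refine ⟨fun p hp => ⟨?_, ?_⟩, fun E hE => ?_⟩
  · filter_upwards [mem_nhdsWithin_of_mem_nhds (hW.mem_nhds (hNW hp)), self_mem_nhdsWithin]
      with q hqW hqP
    exact lt_add_of_pos_right _ (mul_pos (hpos₂ q) (hWP q ⟨hqW, hqP⟩))
  · filter_upwards [mem_nhdsWithin_of_mem_nhds (hW.mem_nhds (hNW hp)), self_mem_nhdsWithin]
      with q hqW hqM
    exact add_lt_of_neg_right _ (mul_neg_of_pos_of_neg (hpos₂ q) (hWM q ⟨hqW, hqM⟩))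
  · obtain ⟨fE, hfE, hfE0, hfEL, hfEP, hfEM⟩ := exists_glued g V hf₂ hr hpos₂ hpos₁ hL₂ hL₁ hP hM
      hdisj hsep (isOpen_interior.inter hW)
      (subset_inter (subset_interior_iff_mem_nhdsSet.2 hE) hNW) (fun p hp => hgrad p hp.2)
      (fun p hp => hWP p ⟨hp.1.2, hp.2⟩) (fun p hp => hWM p ⟨hp.1.2, hp.2⟩)
    exact ⟨fE, hfE, hfE0, hfEL, fun p hp => hfEP p ⟨hp.1, fun h => hp.2 (interior_subset h.1)⟩,
      fun p hp => hfEM p ⟨hp.1, fun h => hp.2 (interior_subset h.1)⟩⟩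

theorem mainTheorem8 (n : ℕ) (hn : 2 ≤ n)
    {F : Type*} [TopologicalSpace F] [T2Space F] [SecondCountableTopology F]
    [ChartedSpace (EuclideanSpace ℝ (Fin n)) F] [IsManifold (𝓡 n) ∞ F]
    (g : ConformalSmoothing.SmoothMetric n F)
    {N : Type*} [TopologicalSpace N]
    [ChartedSpace (EuclideanSpace ℝ (Fin (n - 1))) N] [IsManifold (𝓡 (n - 1)) ∞ N]
    (ι : N → F) (hι : Manifold.IsSmoothEmbedding (𝓡 (n - 1)) (𝓡 n) ∞ ι)
    -- the unit normal of the hypersurface `ι(N)`, which separates `F` into the sides `P`, `M`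
    (ν : ∀ x : N, TangentSpace (𝓡 n) (ι x))
    (hν : ∀ x, ConformalSmoothing.IsUnitNormal g ι x (ν x))
    (P M : Set F) (hP : IsOpen P) (hM : IsOpen M) (hdisj : Disjoint P M)
    (hsep : P ∪ M = (range ι)ᶜ)
    (hνP : ∀ x, ConformalSmoothing.PointsInto (ι x) (ν x) P)
    (hνM : ∀ x, ConformalSmoothing.PointsInto (ι x) (-ν x) M)
    (f₁ f₂ : F → ℝ)
    (hf₁ : ContMDiff (𝓡 n) 𝓘(ℝ, ℝ) ∞ f₁) (hf₂ : ContMDiff (𝓡 n) 𝓘(ℝ, ℝ) ∞ f₂)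
    (hpos₁ : ∀ p, 0 < f₁ p) (hpos₂ : ∀ p, 0 < f₂ p)
    (hL₁ : ∀ p, 0 < ConformalSmoothing.conformalLaplacian g f₁ p)
    (hL₂ : ∀ p, 0 < ConformalSmoothing.conformalLaplacian g f₂ p)
    (heq : ∀ x, f₁ (ι x) = f₂ (ι x))
    (hnormal : ∀ x, ConformalSmoothing.dirDeriv f₂ (ι x) (ν x) <
      ConformalSmoothing.dirDeriv f₁ (ι x) (ν x)) :
    -- near the hypersurface, `f₂` is the smaller function on the side `P`, and `f₁` on `M`
    (∀ x, (∀ᶠ q in 𝓝[P] (ι x), f₂ q < f₁ q) ∧ (∀ᶠ q in 𝓝[M] (ι x), f₁ q < f₂ q)) ∧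
    ∀ E ∈ 𝓝ˢ (range ι), ∃ fE : F → ℝ,
      ContMDiff (𝓡 n) 𝓘(ℝ, ℝ) ∞ fE ∧
      (∀ p, 0 < fE p) ∧
      (∀ p, 0 < ConformalSmoothing.conformalLaplacian g fE p) ∧
      (∀ p ∈ P \ E, fE p = f₂ p) ∧
      (∀ p ∈ M \ E, fE p = f₁ p) := by
  have h := mainTheorem8_general g
    (fun p => ((n : ℝ) - 2) / (4 * ((n : ℝ) - 1)) * ConformalSmoothing.scal g p)
    hP hM hdisj hsep hf₁ hf₂ hpos₁ hpos₂ hL₁ hL₂ (forall_mem_range.2 heq)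
    (forall_mem_range.2 fun x => ⟨ν x, hνP x, hνM x, hnormal x⟩)
  exact ⟨fun x => h.1 _ (mem_range_self x), h.2⟩
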